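/- All graphs are finite, undirected and simple. For a graph $H$ and $k\ge 1$, the power $H^k$ is the graph on $V_H$ in which $x,y$ are adjacent iff $1\le d_H(x,y)\le k$. We write $N_G(x)$ for the neighborhood of $x$ in $G$ and $N_G[x]=N_G(x)\cup\{x\}$; a graph is $\{C_3,C_5\}$-free if it contains no cycle of length $3$ or $5$. (i) Let $H$ be a $\{C_3,C_5\}$-free graph and $G=H^2$. Then for every vertex $x$ and every $y\in N_H(x)$, $$N_H(y)=N_G(y)\cap\bigl(N_G[x]\setminus N_H(x)\bigr).$$ (ii) Let $G$ be a connected graph, $v\in V_G$ and $U\subseteq N_G(v)$. Then there is at most one $\{C_3,C_5\}$-free graph $H$ on $V_G$ with $H^2=G$ and $N_H(v)=U$. (iii) Consider the following problem: given a connected graph $G$ on $n$ vertices (by its adjacency matrix), $v\in V_G$ and $U\subseteq N_G(v)$, output the (adjacency matrix of the) $\{C_3,C_5\}$-free graph $H$ with $H^2=G$ and $N_H(v)=U$ if it exists, and report NO otherwise. This problem can be solved in time $O(M(n))$, where $M(n)$ is the time needed to multiply two $n\times n$ matrices. Precisely, on a random access machine with unit-cost instructions on words of $O(\log n)$ bits: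 whenever some program multiplies any two $n\times n$ matrices with entries in $\{0,1\}$ over the integers in at most $M(n)$ steps, for all $n$, there are a program and a constant $C$ such that the program solves the problem in at most $C\cdot M(n)$ steps for all $n$. -/

import Mathlib

/-! ### Graphs -/

namespace SquareRoot

/-- The `k`-th power of a graph: `x` and `y` are adjacent iff their distance is between `1` and `k`. -/
def power {V : Type*} (H : SimpleGraph V) (k : ℕ) : SimpleGraph V where
  Adj x y := 1 ≤ H.edist x y ∧ H.edist x y ≤ k
  symm := ⟨fun x y h => by rwa [SimpleGraph.edist_comm]⟩
  loopless := ⟨fun x h => by simp at h⟩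

/-- `H` is `{C₃, C₅}`-free. -/
def C3C5Free {V : Type*} (H : SimpleGraph V) : Prop :=
  (SimpleGraph.cycleGraph 3).Free H ∧ (SimpleGraph.cycleGraph 5).Free H

/-- `H` is a `{C₃, C₅}`-free square root of `G` in which the neighborhood of `v` is `U`. -/
def IsRootWithNbhd {V : Type*} (G : SimpleGraph V) (v : V) (U : Set V) (H : SimpleGraph V) : Prop :=
  C3C5Free H ∧ power H 2 = G ∧ H.neighborSet v = U

/-! ### The machine: a random access machine with unit-cost instructions on bounded words

The memory consists of registers and arrays (indexed by natural numbers), all of whose entries are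
natural numbers. A program is built from elementary instructions by sequencing, branching and
while loops. A program text mentions only finitely many registers and arrays. -/

/-- The arithmetic instructions (subtraction is truncated). -/
inductive Op
  | add | sub | mul | div | mod

/-- The value of an arithmetic instruction. -/
def Op.eval : Op → ℕ → ℕ → ℕ
  | .add, a, b => a + b
  | .sub, a, b => a - b
  | .mul, a, b => a * b
  | .div, a, b => a / b
  | .mod, a, b => a % b

/-- Programs. Arguments `x y z i` name registers, the argument `a` names an array:
* `const x k`: register `x` gets the constant `k`;
* `arith o x y z`: register `x` gets the result of `o` on the contents of registers `y`, `z`;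
* `load x a i`: register `x` gets the entry of array `a` at the position held in register `i`;
* `store a i x`: that entry gets the content of register `x`;
* `branch x p q`: run `p` if register `x` is nonzero, otherwise `q`;
* `loop x p`: while register `x` is nonzero, run `p`. -/
inductive Prog
  | skip : Prog
  | const (x k : ℕ) : Prog
  | arith (o : Op) (x y z : ℕ) : Prog
  | load (x a i : ℕ) : Prog
  | store (a i x : ℕ) : Prog
  | seq (p q : Prog) : Prog
  | branch (x : ℕ) (p q : Prog) : Prog
  | loop (x : ℕ) (p : Prog) : Prog

/-- The content of the memory. -/
structure State where
  /-- the contents of the registers -/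
  reg : ℕ → ℕ
  /-- the contents of the arrays: `arr a k` is the entry of array `a` at position `k` -/
  arr : ℕ → ℕ → ℕ

/-- Overwrite register `x` by `k`. -/
def State.setReg (s : State) (x k : ℕ) : State :=
  { s with reg := Function.update s.reg x k }

/-- Overwrite position `i` of array `a` by `k`. -/
def State.setArr (s : State) (a i k : ℕ) : State :=
  { s with arr := Function.update s.arr a (Function.update (s.arr a) i k) }

/-- `Exec B p s t s'`: started in `s`, the program `p` halts in `s'` after exactly `t` steps, and
every number that it produces on the way is smaller than `B`. Every elementary instruction and
every test of a branch or a loop takes one step. An instruction whose result is not smaller than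
`B` cannot be executed. -/
inductive Exec (B : ℕ) : Prog → State → ℕ → State → Prop
  | skip (s : State) : Exec B .skip s 1 s
  | const (x k : ℕ) (s : State) (h : k < B) : Exec B (.const x k) s 1 (s.setReg x k)
  | arith (o : Op) (x y z : ℕ) (s : State) (h : o.eval (s.reg y) (s.reg z) < B) :
      Exec B (.arith o x y z) s 1 (s.setReg x (o.eval (s.reg y) (s.reg z)))
  | load (x a i : ℕ) (s : State) :
      Exec B (.load x a i) s 1 (s.setReg x (s.arr a (s.reg i)))
  | store (a i x : ℕ) (s : State) :
      Exec B (.store a i x) s 1 (s.setArr a (s.reg i) (s.reg x))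
  | seq {p q : Prog} {s s' s'' : State} {t u : ℕ} (hp : Exec B p s t s') (hq : Exec B q s' u s'') :
      Exec B (.seq p q) s (t + u) s''
  | branch_true {x : ℕ} {p q : Prog} {s s' : State} {t : ℕ} (hx : s.reg x ≠ 0)
      (hp : Exec B p s t s') : Exec B (.branch x p q) s (t + 1) s'
  | branch_false {x : ℕ} {p q : Prog} {s s' : State} {t : ℕ} (hx : s.reg x = 0)
      (hq : Exec B q s t s') : Exec B (.branch x p q) s (t + 1) s'
  | loop_done {x : ℕ} {p : Prog} {s : State} (hx : s.reg x = 0) : Exec B (.loop x p) s 1 s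
  | loop_step {x : ℕ} {p : Prog} {s s' s'' : State} {t u : ℕ} (hx : s.reg x ≠ 0)
      (hp : Exec B p s t s') (hl : Exec B (.loop x p) s' u s'') :
      Exec B (.loop x p) s (t + u + 1) s''

/-! ### Inputs, outputs and running times -/

/-- The array that holds an `n × n` matrix row by row: entry `(i, j)` is at position `i * n + j`.
All other positions hold `0`. -/
def matrixArray {n : ℕ} (A : Matrix (Fin n) (Fin n) ℕ) (k : ℕ) : ℕ :=
  if h : k < n * n then
    A ⟨k / n, Nat.div_lt_of_lt_mul h⟩
      ⟨k % n, Nat.mod_lt k (Nat.pos_of_ne_zero fun h0 => by simp [h0] at h)⟩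
  else 0

open Classical in
/-- The adjacency matrix of a graph on the vertices `0, …, n - 1`. -/
noncomputable def adjacency {n : ℕ} (G : SimpleGraph (Fin n)) : Matrix (Fin n) (Fin n) ℕ :=
  fun i j => if G.Adj i j then 1 else 0

open Classical in
/-- The array that holds the characteristic vector of a set of vertices. -/
noncomputable def setArray {n : ℕ} (U : Set (Fin n)) (k : ℕ) : ℕ :=
  if ∃ u ∈ U, (u : ℕ) = k then 1 else 0

/-- Initial state for multiplying `A` and `B`: `n` is in register `0`, the matrices are in the
arrays `0` and `1`, and the rest of the memory is `0`. -/
def mulInput {n : ℕ} (A B : Matrix (Fin n) (Fin n) ℕ) : State where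
  reg x := if x = 0 then n else 0
  arr a := if a = 0 then matrixArray A else if a = 1 then matrixArray B else fun _ => 0

/-- The program `P` multiplies any two `n × n` matrices with entries in `{0, 1}` (over the
integers) in at most `T n` steps, on words of `O(log n)` bits; the product is left in array `2`.
(A program that multiplies matrices with arbitrary integer entries does so in particular.) -/
def MultipliesMatricesIn (P : Prog) (T : ℕ → ℕ) : Prop :=
  ∃ c : ℕ, ∀ (n : ℕ) (A B : Matrix (Fin n) (Fin n) ℕ),
    (∀ i j, A i j = 0 ∨ A i j = 1) → (∀ i j, B i j = 0 ∨ B i j = 1) →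
    ∃ (t : ℕ) (s : State), Exec ((n + 2) ^ c) P (mulInput A B) t s ∧ t ≤ T n ∧
      ∀ i j : Fin n, s.arr 2 (i * n + j) = (A * B) i j

/-- Initial state for the instance `(G, v, U)`: `n` and `v` are in the registers `0` and `1`, the
adjacency matrix of `G` is in array `0`, the characteristic vector of `U` is in array `1`, and the
rest of the memory is `0`. -/
noncomputable def rootInput {n : ℕ} (G : SimpleGraph (Fin n)) (v : Fin n) (U : Set (Fin n)) :
    State where
  reg x := if x = 0 then n else if x = 1 then v else 0
  arr a := if a = 0 then matrixArray (adjacency G) else if a = 1 then setArray U else fun _ => 0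

/-- On every instance `(G, v, U)` with `G` a connected graph on `n` vertices and `U ⊆ N_G(v)`, the
program `Q` halts after at most `S n` steps, on words of `O(log n)` bits. If there is a
`{C₃, C₅}`-free square root `H` of `G` with `N_H(v) = U`, then register `0` holds `1` at the end and
array `2` holds the adjacency matrix of such an `H`; otherwise register `0` holds `0`. -/
def ConstructsRootIn (Q : Prog) (S : ℕ → ℕ) : Prop :=
  ∃ c : ℕ, ∀ (n : ℕ) (G : SimpleGraph (Fin n)) (v : Fin n) (U : Set (Fin n)),
    G.Connected → U ⊆ G.neighborSet v →
    ∃ (t : ℕ) (s : State), Exec ((n + 2) ^ c) Q (rootInput G v U) t s ∧ t ≤ S n ∧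
      ((∃ H, IsRootWithNbhd G v U H) →
        s.reg 0 = 1 ∧ ∃ H, IsRootWithNbhd G v U H ∧
          ∀ i j : Fin n, s.arr 2 (i * n + j) = adjacency H i j) ∧
      ((¬ ∃ H, IsRootWithNbhd G v U H) → s.reg 0 = 0)

end SquareRoot

/-!
If `xy` is an edge of a `{C₃, C₅}`-free root `H` of `G`, then `N_H(y)` can be read off from
`N_H(x)` and `G`: besides `x`, it consists of the common neighbors of `x` and `y` in `G` that
are not adjacent to `x` in `H`. Such a common neighbor `z` has a neighbor in `H` in common with
`x`, and, unless it is adjacent to `y`, one in common with `y` as well, which gives a cycle of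
length five. Hence `N_H(v)` determines a connected root, and a breadth-first search from `v`
finds the only candidate `R` in time `O(n²)`.

The candidate is a root iff `R` is symmetric, `R ∪ (R ∘ R)` is `G` off the diagonal, and neither
`R ∘ R` nor `(G \ R) ∘ (G \ R)` meets `R`; the last condition excludes the cycles of length
five, whose diagonals are at distance two in `H`. Both compositions are read off from squares of
matrices with entries in `{0, 1}`. The remaining time `O(n²)` is absorbed by `M(n)`, since every
program has to write all `n²` entries of the square of the all-ones matrix.
-/

namespace SquareRoot

/-! ### Squares of graphs without cycles of length three and five -/

section Graphs

variable {V : Type*} {H : SimpleGraph V}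

theorem power_two_adj_iff {x y : V} :
    (power H 2).Adj x y ↔ x ≠ y ∧ (H.Adj x y ∨ Relation.Comp H.Adj H.Adj x y) := by
  have hcomp : Relation.Comp H.Adj H.Adj x y ↔ H.commonNeighbors x y ≠ ∅ := by
    simp only [Relation.Comp, ← Set.nonempty_iff_ne_empty, Set.Nonempty,
      SimpleGraph.mem_commonNeighbors, H.adj_comm y]
  change 1 ≤ H.edist x y ∧ H.edist x y ≤ 2 ↔ _
  rw [Order.one_le_iff_ne_zero, Ne, SimpleGraph.edist_eq_zero_iff, ← not_lt,
    SimpleGraph.two_lt_edist_iff, hcomp]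
  tauto

theorem power_two_sdiff_adj_iff {x y : V} : (power H 2 \ H).Adj x y ↔
    x ≠ y ∧ ¬ H.Adj x y ∧ Relation.Comp H.Adj H.Adj x y := by
  rw [SimpleGraph.sdiff_adj, power_two_adj_iff]
  tauto

theorem free_cycleGraph_three_iff : (SimpleGraph.cycleGraph 3).Free H ↔
    ∀ x y, H.Adj x y → ¬ Relation.Comp H.Adj H.Adj x y := by
  classical
  rw [SimpleGraph.Free, SimpleGraph.cycleGraph_isContained_iff (by decide),
    ← SimpleGraph.is3Clique_iff_exists_cycle_length_three]
  simp only [SimpleGraph.is3Clique_iff, Relation.Comp]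
  exact ⟨fun h x y hxy ⟨z, hxz, hzy⟩ => h ⟨_, x, y, z, hxy, hxz, hzy.symm, rfl⟩,
    fun h ⟨_, x, y, z, hxy, hxz, hyz, _⟩ => h x y hxy ⟨z, hxz, hyz.symm⟩⟩

theorem free_cycleGraph_five_iff (h₃ : (SimpleGraph.cycleGraph 3).Free H) :
    (SimpleGraph.cycleGraph 5).Free H ↔
      ∀ x y, H.Adj x y → ¬ Relation.Comp (power H 2 \ H).Adj (power H 2 \ H).Adj x y := by
  rw [free_cycleGraph_three_iff] at h₃
  rw [SimpleGraph.Free, SimpleGraph.cycleGraph_isContained_iff (by decide)]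
  simp only [Relation.Comp, power_two_sdiff_adj_iff] at h₃ ⊢
  constructor
  · rintro h x y hxy ⟨z, ⟨hxz, nxz, a, hxa, haz⟩, hzy, nzy, b, hzb, hby⟩
    refine h ⟨x, .cons hxa (.cons haz (.cons hzb (.cons hby (.cons hxy.symm .nil)))), ?_, rfl⟩
    have hab : a ≠ b := by rintro rfl; exact h₃ x y hxy ⟨a, hxa, hby⟩
    have hay : a ≠ y := by rintro rfl; exact nzy haz.symm
    have hbx : b ≠ x := by rintro rfl; exact nxz hzb.symm
    simp only [SimpleGraph.Walk.isCycle_def, SimpleGraph.Walk.isTrail_def,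
      SimpleGraph.Walk.edges_cons, SimpleGraph.Walk.edges_nil, SimpleGraph.Walk.support_cons,
      SimpleGraph.Walk.support_nil, List.tail_cons, List.nodup_cons, List.mem_cons, Sym2.eq_iff]
    grind [SimpleGraph.Adj.ne]
  · intro h ⟨x, .cons (v := a) hxa (.cons (v := z) haz (.cons (v := b) hzb
      (.cons (v := y) hby (.cons hyx .nil)))), hw, _⟩
    have hnodup := hw.support_nodup
    simp only [SimpleGraph.Walk.support_cons, SimpleGraph.Walk.support_nil,
      List.tail_cons] at hnodup
    have hxz : x ≠ z := by grind
    have hzy : z ≠ y := by grind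
    exact h x y hyx.symm ⟨z, ⟨hxz, fun hadj => h₃ x z hadj ⟨a, hxa, haz⟩, a, hxa, haz⟩,
      hzy, fun hadj => h₃ z y hadj ⟨b, hzb, hby⟩, b, hzb, hby⟩

theorem c3C5Free_iff : C3C5Free H ↔
    (∀ x y, H.Adj x y → ¬ Relation.Comp H.Adj H.Adj x y) ∧
      ∀ x y, H.Adj x y → ¬ Relation.Comp (power H 2 \ H).Adj (power H 2 \ H).Adj x y := by
  rw [← free_cycleGraph_three_iff]
  exact and_congr_right free_cycleGraph_five_iff

theorem C3C5Free.adj_iff (hH : C3C5Free H) {x y : V} (hxy : H.Adj x y) {z : V} :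
    H.Adj y z ↔ z = x ∨ (power H 2).Adj x z ∧ (power H 2).Adj y z ∧ ¬ H.Adj x z := by
  obtain ⟨h₃, h₅⟩ := c3C5Free_iff.1 hH
  constructor
  · intro hyz
    refine or_iff_not_imp_left.2 fun hzx => ⟨?_, ?_, fun hxz => h₃ x y hxy ⟨z, hxz, hyz.symm⟩⟩
    · exact power_two_adj_iff.2 ⟨Ne.symm hzx, .inr ⟨y, hxy, hyz⟩⟩
    · exact power_two_adj_iff.2 ⟨hyz.ne, .inl hyz⟩
  · rintro (rfl | ⟨hxz, hyz, nxz⟩)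
    · exact hxy.symm
    · by_contra nyz
      exact h₅ x y hxy ⟨z, ⟨hxz, nxz⟩, hyz.symm, fun h => nyz h.symm⟩

theorem C3C5Free.neighborSet_eq (hH : C3C5Free H) {x y : V} (hxy : H.Adj x y) :
    H.neighborSet y = (power H 2).neighborSet y ∩
      (insert x ((power H 2).neighborSet x) \ H.neighborSet x) := by
  ext z
  have hyx : (power H 2).Adj y x := power_two_adj_iff.2 ⟨hxy.ne', .inl hxy.symm⟩
  simp only [SimpleGraph.mem_neighborSet, Set.mem_inter_iff, Set.mem_sdiff, Set.mem_insert_iff,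
    hH.adj_iff hxy]
  constructor
  · rintro (rfl | ⟨hxz, hyz, nxz⟩)
    · exact ⟨hyx, .inl rfl, H.irrefl⟩
    · exact ⟨hyz, .inr hxz, nxz⟩
  · tauto

theorem connected_of_power {k : ℕ} (h : (power H k).Connected) : H.Connected := by
  have := h.nonempty
  refine ⟨fun x y => ?_⟩
  induction (SimpleGraph.reachable_iff_reflTransGen x y).1 (h.preconnected x y) with
  | refl => exact .rfl
  | tail _ hyz ih =>
    exact ih.trans
      (SimpleGraph.reachable_of_edist_ne_top (ne_top_of_le_ne_top (ENat.natCast_ne_top k) hyz.2))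

theorem mem_of_connected_of_adj_closed (hH : H.Connected) {S : Set V} {v : V} (hv : v ∈ S)
    (hS : ∀ x ∈ S, ∀ y, H.Adj x y → y ∈ S) (x : V) : x ∈ S := by
  induction (SimpleGraph.reachable_iff_reflTransGen v x).1 (hH.preconnected v x) with
  | refl => exact hv
  | tail _ hxy ih => exact hS _ ih _ hxy

variable {G : SimpleGraph V} {v : V} {U : Set V}

theorem IsRootWithNbhd.connected (hH : IsRootWithNbhd G v U H) (hG : G.Connected) :
    H.Connected :=
  connected_of_power (hH.2.1 ▸ hG)

theorem IsRootWithNbhd.adj_iff (hH : IsRootWithNbhd G v U H) {x y : V} (hxy : H.Adj x y) {z : V} :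
    H.Adj y z ↔ z = x ∨ G.Adj x z ∧ G.Adj y z ∧ ¬ H.Adj x z := by
  rw [hH.1.adj_iff hxy, hH.2.1]

theorem IsRootWithNbhd.unique {H' : SimpleGraph V} (hG : G.Connected)
    (hH : IsRootWithNbhd G v U H) (hH' : IsRootWithNbhd G v U H') : H = H' := by
  have hnbhd : ∀ x, x ∈ {x | H.neighborSet x = H'.neighborSet x} := by
    refine mem_of_connected_of_adj_closed (hH.connected hG) (hH.2.2.trans hH'.2.2.symm) ?_
    intro x hx y hxy
    have hxy' : H'.Adj x y := hx.subset hxy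
    change H.neighborSet y = H'.neighborSet y
    rw [hH.1.neighborSet_eq hxy, hH'.1.neighborSet_eq hxy', hH.2.1, hH'.2.1, hx]
  ext x y
  exact Set.ext_iff.1 (hnbhd x) y

/-- The conditions at the pair `(x, y)` under which `R` is the adjacency relation of a root. -/
structure Passes (G : SimpleGraph V) (v : V) (U : Set V) (R : V → V → Prop)
    (x y : V) : Prop where
  edge : R x y → R y x ∧ ¬ Relation.Comp R R x y ∧
    ¬ Relation.Comp (fun a b => G.Adj a b ∧ ¬ R a b) (fun a b => G.Adj a b ∧ ¬ R a b) x y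
  nbhd : x = v → (R x y ↔ y ∈ U)
  square : x ≠ y → (G.Adj x y ↔ R x y ∨ Relation.Comp R R x y)

theorem passes_iff {R : V → V → Prop} {x y : V} : Passes G v U R x y ↔
      ((R x y → R y x ∧ ¬ Relation.Comp R R x y ∧
        ¬ Relation.Comp (fun a b => G.Adj a b ∧ ¬ R a b)
          (fun a b => G.Adj a b ∧ ¬ R a b) x y) ∧ (x = v → (R x y ↔ y ∈ U))) ∧
      (x ≠ y → (G.Adj x y ↔ R x y ∨ Relation.Comp R R x y)) :=
  ⟨fun h => ⟨⟨h.edge, h.nbhd⟩, h.square⟩, fun h => ⟨h.1.1, h.1.2, h.2⟩⟩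

theorem forall_passes_iff {R : V → V → Prop} :
    (∀ x y, Passes G v U R x y) ↔ ∃ H, IsRootWithNbhd G v U H ∧ H.Adj = R := by
  constructor
  · intro h
    let H : SimpleGraph V :=
      { Adj := R
        symm := ⟨fun x y hxy => ((h x y).edge hxy).1⟩
        loopless := ⟨fun x hx => ((h x x).edge hx).2.1 ⟨x, hx, hx⟩⟩ }
    have hpower : power H 2 = G := by
      ext x y
      rw [power_two_adj_iff]
      exact ⟨fun hxy => ((h x y).square hxy.1).2 hxy.2,
        fun hxy => ⟨hxy.ne, ((h x y).square hxy.ne).1 hxy⟩⟩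
    have hfree : C3C5Free H := by
      refine c3C5Free_iff.2 ⟨fun x y hxy => ((h x y).edge hxy).2.1, fun x y hxy => ?_⟩
      rw [hpower]
      exact ((h x y).edge hxy).2.2
    exact ⟨H, ⟨hfree, hpower, Set.ext fun y => (h v y).nbhd rfl⟩, rfl⟩
  · rintro ⟨H, ⟨hfree, rfl, rfl⟩, rfl⟩ x y
    obtain ⟨h₃, h₅⟩ := c3C5Free_iff.1 hfree
    refine ⟨fun hxy => ⟨hxy.symm, h₃ x y hxy, h₅ x y hxy⟩, ?_, fun hne => ?_⟩
    · rintro rfl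
      rfl
    · rw [power_two_adj_iff, and_iff_right hne]

end Graphs

/-! ### Reasoning about programs -/

section Programs

variable {B : ℕ} {p q : Prog} {s s' : State} {t : ℕ}

/-- The names of the registers and the arrays that a program may change. A register and an array
with the same name are not distinguished. -/
def Prog.writes : Prog → List ℕ
  | .skip => []
  | .const x _ => [x]
  | .arith _ x _ _ => [x]
  | .load x _ _ => [x]
  | .store a _ _ => [a]
  | .seq p q => p.writes ++ q.writes
  | .branch _ p q => p.writes ++ q.writes
  | .loop _ p => p.writes

/-- The states `s` and `s'` have the same registers and arrays with names in `K`. -/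
def State.AgreesOn (K : Set ℕ) (s s' : State) : Prop :=
  Set.EqOn s.reg s'.reg K ∧ Set.EqOn s.arr s'.arr K

namespace State

@[simp]
theorem reg_setReg (s : State) (x k y : ℕ) :
    (s.setReg x k).reg y = if y = x then k else s.reg y :=
  Function.update_apply ..

@[simp]
theorem arr_setReg (s : State) (x k : ℕ) : (s.setReg x k).arr = s.arr :=
  rfl

@[simp]
theorem reg_setArr (s : State) (a i k : ℕ) : (s.setArr a i k).reg = s.reg :=
  rfl

@[simp]
theorem arr_setArr (s : State) (a i k b : ℕ) :
    (s.setArr a i k).arr b = if b = a then Function.update (s.arr a) i k else s.arr b :=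
  Function.update_apply ..

theorem AgreesOn.refl (K : Set ℕ) (s : State) : s.AgreesOn K s :=
  ⟨fun _ _ => rfl, fun _ _ => rfl⟩

theorem AgreesOn.trans {K : Set ℕ} {s'' : State} (h : s.AgreesOn K s') (h' : s'.AgreesOn K s'') :
    s.AgreesOn K s'' :=
  ⟨h.1.trans h'.1, h.2.trans h'.2⟩

theorem AgreesOn.mono {K L : Set ℕ} (h : s.AgreesOn L s') (hKL : K ⊆ L) : s.AgreesOn K s' :=
  ⟨h.1.mono hKL, h.2.mono hKL⟩

theorem agreesOn_setReg {K : Set ℕ} {x : ℕ} (hx : x ∉ K) (s : State) (k : ℕ) :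
    (s.setReg x k).AgreesOn K s :=
  ⟨fun _ hy => Function.update_of_ne (ne_of_mem_of_not_mem hy hx) .., fun _ _ => rfl⟩

theorem agreesOn_setArr {K : Set ℕ} {a : ℕ} (ha : a ∉ K) (s : State) (i k : ℕ) :
    (s.setArr a i k).AgreesOn K s :=
  ⟨fun _ _ => rfl, fun _ hb => Function.update_of_ne (ne_of_mem_of_not_mem hb ha) ..⟩

end State

theorem Exec.agreesOn (h : Exec B p s t s') {K : Set ℕ} (hK : ∀ x ∈ p.writes, x ∉ K) :
    s'.AgreesOn K s := by
  induction h with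
  | skip s | loop_done => exact .refl _ _
  | const | arith | load => exact State.agreesOn_setReg (hK _ (List.mem_singleton_self _)) ..
  | store => exact State.agreesOn_setArr (hK _ (List.mem_singleton_self _)) ..
  | seq _ _ ihp ihq =>
    simp only [Prog.writes, List.forall_mem_append] at hK
    exact (ihq hK.2).trans (ihp hK.1)
  | branch_true _ _ ih =>
    simp only [Prog.writes, List.forall_mem_append] at hK
    exact ih hK.1
  | branch_false _ _ ih =>
    simp only [Prog.writes, List.forall_mem_append] at hK
    exact ih hK.2
  | loop_step _ _ _ ihp ihl => exact (ihl hK).trans (ihp hK)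

theorem Exec.mono (h : Exec B p s t s') {B' : ℕ} (hB : B ≤ B') : Exec B' p s t s' := by
  induction h with
  | skip s => exact .skip s
  | const x k s h => exact .const x k s (h.trans_le hB)
  | arith o x y z s h => exact .arith o x y z s (h.trans_le hB)
  | load x a i s => exact .load x a i s
  | store a i x s => exact .store a i x s
  | seq _ _ ihp ihq => exact .seq ihp ihq
  | branch_true hx _ ih => exact .branch_true hx ih
  | branch_false hx _ ih => exact .branch_false hx ih
  | loop_done hx => exact .loop_done hx
  | loop_step hx _ _ ihp ihl => exact .loop_step hx ihp ihl

/-- Started in `s`, the program `p` halts after at most `T` steps in a state that satisfies `Q`,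
and every number that it produces on the way is smaller than `B`. -/
def Runs (B : ℕ) (p : Prog) (s : State) (T : ℕ) (Q : State → Prop) : Prop :=
  ∃ t s', Exec B p s t s' ∧ t ≤ T ∧ Q s'

namespace Runs

variable {T T' : ℕ} {Q R : State → Prop}

theorem mono (h : Runs B p s T Q) {B' : ℕ} (hB : B ≤ B') (hT : T ≤ T')
    (hQ : ∀ s', Q s' → R s') : Runs B' p s T' R := by
  obtain ⟨t, s', hexec, ht, hs'⟩ := h
  exact ⟨t, s', hexec.mono hB, ht.trans hT, hQ s' hs'⟩

theorem seq (hp : Runs B p s T Q) (hq : ∀ s', Q s' → Runs B q s' T' R) :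
    Runs B (.seq p q) s (T + T') R := by
  obtain ⟨t, s', hexec, ht, hs'⟩ := hp
  obtain ⟨t', s'', hexec', ht', hs''⟩ := hq s' hs'
  exact ⟨t + t', s'', hexec.seq hexec', add_le_add ht ht', hs''⟩

theorem branch {x : ℕ} (hp : s.reg x ≠ 0 → Runs B p s T Q) (hq : s.reg x = 0 → Runs B q s T' Q) :
    Runs B (.branch x p q) s (max T T' + 1) Q := by
  by_cases hx : s.reg x = 0
  · obtain ⟨t, s', hexec, ht, hs'⟩ := hq hx
    exact ⟨t + 1, s', .branch_false hx hexec, by omega, hs'⟩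
  · obtain ⟨t, s', hexec, ht, hs'⟩ := hp hx
    exact ⟨t + 1, s', .branch_true hx hexec, by omega, hs'⟩

theorem frame (h : Runs B p s T Q) {K : Set ℕ} (hK : ∀ x ∈ p.writes, x ∉ K) :
    Runs B p s T fun s' => s'.AgreesOn K s ∧ Q s' := by
  obtain ⟨t, s', hexec, ht, hs'⟩ := h
  exact ⟨t, s', hexec, ht, hexec.agreesOn hK, hs'⟩

theorem countdown {x : ℕ} {I : ℕ → State → Prop}
    (hI : ∀ r s, s.reg x = r + 1 → I (r + 1) s →
      Runs B p s T fun s' => s'.reg x = r ∧ I r s') (r : ℕ) :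
    ∀ s, s.reg x = r → I r s → Runs B (.loop x p) s (r * (T + 1) + 1) (I 0) := by
  induction r with
  | zero => exact fun s hx hs => ⟨1, s, .loop_done hx, by simp, hs⟩
  | succ r ih =>
    intro s hx hs
    obtain ⟨t, s', hexec, ht, hx', hs'⟩ := hI r s hx hs
    obtain ⟨t', s'', hexec', ht', hs''⟩ := ih s' hx' hs'
    exact ⟨t + t' + 1, s'', .loop_step (by simp [hx]) hexec hexec', by linarith, hs''⟩

end Runs

namespace Prog

/-- The weakest precondition of the postcondition `Q` for a program without loops. -/
def wp (B : ℕ) : Prog → (State → Prop) → State → Prop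
  | .skip, Q, s => Q s
  | .const x k, Q, s => k < B ∧ Q (s.setReg x k)
  | .arith o x y z, Q, s =>
      o.eval (s.reg y) (s.reg z) < B ∧ Q (s.setReg x (o.eval (s.reg y) (s.reg z)))
  | .load x a i, Q, s => Q (s.setReg x (s.arr a (s.reg i)))
  | .store a i x, Q, s => Q (s.setArr a (s.reg i) (s.reg x))
  | .seq p q, Q, s => p.wp B (q.wp B Q) s
  | .branch x p q, Q, s => if s.reg x = 0 then q.wp B Q s else p.wp B Q s
  | .loop _ _, _, _ => False

/-- A bound for the running time of a program without loops. -/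
def cost : Prog → ℕ
  | .seq p q => p.cost + q.cost
  | .branch _ p q => max p.cost q.cost + 1
  | _ => 1

theorem runs_of_wp {Q : State → Prop} (h : p.wp B Q s) : Runs B p s p.cost Q := by
  induction p generalizing Q s with
  | skip => exact ⟨1, s, .skip s, le_rfl, h⟩
  | const => exact ⟨1, _, .const _ _ _ h.1, le_rfl, h.2⟩
  | arith => exact ⟨1, _, .arith _ _ _ _ _ h.1, le_rfl, h.2⟩
  | load => exact ⟨1, _, .load _ _ _ _, le_rfl, h⟩
  | store => exact ⟨1, _, .store _ _ _ _, le_rfl, h⟩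
  | seq p q ihp ihq => exact (ihp h).seq fun _ => ihq
  | branch x p q ihp ihq =>
    unfold wp at h
    exact Runs.branch (fun hx => ihp (by rwa [if_neg hx] at h))
      fun hx => ihq (by rwa [if_pos hx] at h)
  | loop => exact h.elim

/-- The program that works on the registers and arrays with names `f 0`, `f 1`, … as `p` does on
those with names `0`, `1`, …. -/
def rename (f : ℕ → ℕ) : Prog → Prog
  | .skip => .skip
  | .const x k => .const (f x) k
  | .arith o x y z => .arith o (f x) (f y) (f z)
  | .load x a i => .load (f x) (f a) (f i)
  | .store a i x => .store (f a) (f i) (f x)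
  | .seq p q => .seq (p.rename f) (q.rename f)
  | .branch x p q => .branch (f x) (p.rename f) (q.rename f)
  | .loop x p => .loop (f x) (p.rename f)

theorem writes_rename (f : ℕ → ℕ) (p : Prog) : (p.rename f).writes = p.writes.map f := by
  induction p <;> simp_all [rename, writes]

end Prog

/-- The memory that a program renamed by `f` works on. -/
def State.view (f : ℕ → ℕ) (s : State) : State where
  reg x := s.reg (f x)
  arr a := s.arr (f a)

theorem State.view_setReg {f : ℕ → ℕ} (hf : f.Injective) (s : State) (x k : ℕ) :
    (s.setReg (f x) k).view f = (s.view f).setReg x k := by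
  simp only [view, setReg, State.mk.injEq, and_true]
  exact Function.update_comp_eq_of_injective s.reg hf x k

theorem State.view_setArr {f : ℕ → ℕ} (hf : f.Injective) (s : State) (a i k : ℕ) :
    (s.setArr (f a) i k).view f = (s.view f).setArr a i k := by
  simp only [view, setArr, State.mk.injEq, true_and]
  exact Function.update_comp_eq_of_injective s.arr hf a _

theorem State.AgreesOn.view_eq {f : ℕ → ℕ} (h : s'.AgreesOn (Set.range f) s) :
    s'.view f = s.view f := by
  simp only [State.view, State.mk.injEq]
  exact ⟨funext fun x => h.1 ⟨x, rfl⟩, funext fun a => h.2 ⟨a, rfl⟩⟩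

theorem State.view_setReg_of_notMem {f : ℕ → ℕ} {x : ℕ} (hx : x ∉ Set.range f) (s : State)
    (k : ℕ) : (s.setReg x k).view f = s.view f :=
  (State.agreesOn_setReg hx s k).view_eq

theorem State.view_setArr_of_notMem {f : ℕ → ℕ} {a : ℕ} (ha : a ∉ Set.range f) (s : State)
    (i k : ℕ) : (s.setArr a i k).view f = s.view f :=
  (State.agreesOn_setArr ha s i k).view_eq

theorem Exec.rename {f : ℕ → ℕ} (hf : f.Injective) (h : Exec B p s t s') (S : State)
    (hS : S.view f = s) : ∃ S', Exec B (p.rename f) S t S' ∧ S'.view f = s' := by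
  induction h generalizing S with subst hS
  | skip => exact ⟨S, .skip S, rfl⟩
  | const x k _ h => exact ⟨_, .const _ _ _ h, State.view_setReg hf _ _ _⟩
  | arith o x y z _ h => exact ⟨_, .arith o _ _ _ _ h, State.view_setReg hf _ _ _⟩
  | load => exact ⟨_, .load _ _ _ _, State.view_setReg hf _ _ _⟩
  | store => exact ⟨_, .store _ _ _ _, State.view_setArr hf _ _ _ _⟩
  | seq _ _ ihp ihq =>
    obtain ⟨S', hexec, hS'⟩ := ihp S rfl
    obtain ⟨S'', hexec', hS''⟩ := ihq S' hS'
    exact ⟨S'', .seq hexec hexec', hS''⟩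
  | branch_true hx _ ih =>
    obtain ⟨S', hexec, hS'⟩ := ih S rfl
    exact ⟨S', .branch_true hx hexec, hS'⟩
  | branch_false hx _ ih =>
    obtain ⟨S', hexec, hS'⟩ := ih S rfl
    exact ⟨S', .branch_false hx hexec, hS'⟩
  | loop_done hx => exact ⟨S, .loop_done hx, rfl⟩
  | loop_step hx _ _ ihp ihl =>
    obtain ⟨S', hexec, hS'⟩ := ihp S rfl
    obtain ⟨S'', hexec', hS''⟩ := ihl S' hS'
    exact ⟨S'', .loop_step hx hexec hexec', hS''⟩

theorem Runs.rename {f : ℕ → ℕ} (hf : f.Injective) {T : ℕ} {Q : State → Prop}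
    (h : Runs B p (s.view f) T Q) : Runs B (p.rename f) s T fun s' =>
      s'.AgreesOn (Set.range f)ᶜ s ∧ Q (s'.view f) := by
  obtain ⟨t, _, hexec, ht, hQ⟩ := h
  obtain ⟨s', hexec', rfl⟩ := hexec.rename hf s rfl
  refine Runs.frame ⟨t, s', hexec', ht, hQ⟩ fun x hx => ?_
  obtain ⟨y, -, rfl⟩ := List.mem_map.1 (p.writes_rename f ▸ hx)
  exact Set.notMem_compl_iff.2 (Set.mem_range_self y)

end Programs

/-! ### Loops over the positions of a matrix -/

local infixr:60 " ;; " => Prog.seq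

section Grid

-- A register and an array that a program changes get different names, because `Prog.writes` does
-- not distinguish them.
@[simp] abbrev Reg.one : ℕ := 10
@[simp] abbrev Reg.area : ℕ := 11
@[simp] abbrev Reg.left : ℕ := 12
@[simp] abbrev Reg.pos : ℕ := 13
@[simp] abbrev Reg.row : ℕ := 14
@[simp] abbrev Reg.col : ℕ := 15

/-- The registers that control a loop over the positions of a matrix. -/
def gridRegs : Set ℕ :=
  Set.Icc 10 15

theorem insert_gridRegs_subset : insert 0 gridRegs ⊆ Set.Iio 16 := by
  rintro k (rfl | hk)
  exacts [Nat.succ_pos 15, Nat.lt_succ_of_le hk.2]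

theorem subset_gridRegs_compl : Set.Iio 3 ∪ Set.Ici 100 ⊆ gridRegsᶜ := by
  rintro x (hx | hx) hgrid
  · exact absurd (hgrid.1.trans_lt hx) (by simp)
  · exact absurd (le_trans hx hgrid.2) (by simp)

/-- Advance the control registers of a loop over the positions of a matrix by one position. -/
def Prog.gridStep : Prog :=
  .arith .sub Reg.pos Reg.area Reg.left ;;
  .arith .sub Reg.left Reg.left Reg.one ;;
  .arith .div Reg.row Reg.pos 0 ;;
  .arith .mod Reg.col Reg.pos 0

/-- Set up the control registers of a loop over the positions of a matrix. -/
def Prog.gridInit : Prog :=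
  .const Reg.one 1 ;;
  .arith .mul Reg.area 0 0 ;;
  .arith .mul Reg.left 0 0

/-- Run `body` for all positions of a matrix, row by row; the number of rows and of columns is
in register `0`. -/
def Prog.forGrid (body : Prog) : Prog :=
  gridInit ;; .loop Reg.left (gridStep ;; body)

/-- A loop over the positions of an `n × n` matrix has reached the entry `(i, j)`. -/
structure GridAt {n : ℕ} (i j : Fin n) (s : State) : Prop where
  size : s.reg 0 = n
  one : s.reg Reg.one = 1
  pos : s.reg Reg.pos = i * n + j
  row : s.reg Reg.row = i
  col : s.reg Reg.col = j

theorem GridAt.of_agreesOn {n : ℕ} {i j : Fin n} {s s' : State} (h : GridAt i j s) {K : Set ℕ}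
    (hs : s'.AgreesOn K s) (hK : insert 0 gridRegs ⊆ K) : GridAt i j s' where
  size := (hs.1 (hK (by simp))).trans h.size
  one := (hs.1 (hK (by simp [gridRegs]))).trans h.one
  pos := (hs.1 (hK (by simp [gridRegs]))).trans h.pos
  row := (hs.1 (hK (by simp [gridRegs]))).trans h.row
  col := (hs.1 (hK (by simp [gridRegs]))).trans h.col

variable {B n c : ℕ} {body : Prog} {I : ℕ → State → Prop} {s : State}

theorem Prog.runs_gridStep (hB : n * n < B) {r : ℕ} (hr : r < n * n)
    (h0 : s.reg 0 = n) (hone : s.reg Reg.one = 1) (harea : s.reg Reg.area = n * n)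
    (hleft : s.reg Reg.left = r + 1) :
    Runs B gridStep s 4 fun s' => s'.AgreesOn gridRegsᶜ s ∧ s'.reg Reg.area = n * n ∧
      s'.reg Reg.left = r ∧
      ∃ i j : Fin n, (i * n + j : ℕ) = n * n - (r + 1) ∧ GridAt i j s' := by
  have hk : n * n - (r + 1) < n * n := by omega
  have hn : 0 < n := Nat.pos_of_mul_pos_left (Nat.zero_lt_of_lt hk)
  have hdiv := (Nat.div_le_self (n * n - (r + 1)) n).trans_lt (hk.trans hB)
  have hmod := (Nat.mod_le (n * n - (r + 1)) n).trans_lt (hk.trans hB)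
  refine (Runs.frame (runs_of_wp (Q := fun s' => s'.reg Reg.area = n * n ∧
    s'.reg Reg.left = r ∧ ∃ i j : Fin n, (i * n + j : ℕ) = n * n - (r + 1) ∧ GridAt i j s') ?_)
    (K := gridRegsᶜ) ?_)
  · simp only [gridStep, wp, Op.eval, Reg.area, Reg.left, Reg.pos, Reg.one, Reg.row, Reg.col,
      State.reg_setReg, Nat.reduceEqDiff, ↓reduceIte, OfNat.zero_ne_ofNat, Nat.succ_ne_self, h0,
      hone, harea, hleft, add_tsub_cancel_right, true_and]
    refine ⟨hk.trans hB, hr.trans hB, hdiv, hmod, ⟨_, Nat.div_lt_of_lt_mul hk⟩,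
      ⟨_, Nat.mod_lt _ hn⟩, Nat.div_add_mod' .., ?_⟩
    constructor <;> simp [h0, hone, Nat.div_add_mod']
  · simp [gridStep, writes, gridRegs]

theorem Runs.forGrid (hB : n * n + 1 < B) (hw : ∀ x ∈ body.writes, x ∉ insert 0 gridRegs)
    (hI : ∀ k s s', s'.AgreesOn gridRegsᶜ s → I k s → I k s')
    (hbody : ∀ (i j : Fin n) s, GridAt i j s → I (i * n + j) s →
      Runs B body s c (I (i * n + j + 1)))
    (h0 : s.reg 0 = n) (hs : I 0 s) :
    Runs B body.forGrid s (n * n * (c + 5) + 4) (I (n * n)) := by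
  let J (r : ℕ) (s : State) : Prop := s.reg 0 = n ∧ s.reg Reg.one = 1 ∧
    s.reg Reg.area = n * n ∧ r ≤ n * n ∧ I (n * n - r) s
  have hround (r : ℕ) (s : State) (hleft : s.reg Reg.left = r + 1) (hs : J (r + 1) s) :
      Runs B (Prog.gridStep ;; body) s (4 + c) fun s' => s'.reg Reg.left = r ∧ J r s' := by
    obtain ⟨h0, hone, harea, hr, hs⟩ := hs
    refine (Prog.runs_gridStep (by omega) hr h0 hone harea hleft).seq ?_
    rintro s' ⟨hagrees, harea', hleft', i, j, hij, hat⟩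
    refine ((hbody i j s' hat (hij ▸ hI _ s s' hagrees hs)).frame hw).mono le_rfl le_rfl ?_
    rintro s'' ⟨hkeep, hs''⟩
    have hat' := hat.of_agreesOn hkeep le_rfl
    refine ⟨?_, hat'.size, hat'.one, ?_, by omega, ?_⟩
    · exact (hkeep.1 (by simp [gridRegs])).trans hleft'
    · exact (hkeep.1 (by simp [gridRegs])).trans harea'
    · rwa [show n * n - r = i * n + j + 1 by omega]
  have hinit : Runs B Prog.gridInit s 3 fun s' => s'.reg Reg.left = n * n ∧ J (n * n) s' := by
    refine ((Prog.runs_of_wp (Q := fun s' => s'.reg 0 = n ∧ s'.reg Reg.one = 1 ∧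
      s'.reg Reg.area = n * n ∧ s'.reg Reg.left = n * n) ?_).frame (K := gridRegsᶜ) ?_).mono
      le_rfl le_rfl ?_
    · have hB' : 1 < B ∧ n * n < B := by omega
      simp [Prog.gridInit, Prog.wp, Op.eval, h0, hB']
    · simp [Prog.gridInit, Prog.writes, gridRegs]
    · rintro s' ⟨hagrees, h0', hone, harea, hleft⟩
      exact ⟨hleft, h0', hone, harea, le_rfl, hI _ _ _ hagrees (by rwa [Nat.sub_self])⟩
  refine (hinit.seq fun s' hs' => Runs.countdown hround _ s' hs'.1 hs'.2).mono le_rfl ?_ ?_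
  · exact le_of_eq (by ring)
  · exact fun s' hs' => hs'.2.2.2.2

end Grid

/-! ### Arrays -/

section Encodings

variable {n : ℕ}

theorem entry_lt (i j : Fin n) : (i * n + j : ℕ) < n * n := by
  nlinarith [i.2, j.2]

theorem exists_entry_eq {k : ℕ} (hk : k < n * n) : ∃ i j : Fin n, (i * n + j : ℕ) = k :=
  ⟨⟨k / n, Nat.div_lt_of_lt_mul hk⟩,
    ⟨k % n, Nat.mod_lt k (Nat.pos_of_mul_pos_left (Nat.zero_lt_of_lt hk))⟩,
    Nat.div_add_mod' k n⟩

theorem entry_div (i : ℕ) (j : Fin n) : (i * n + j : ℕ) / n = i := by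
  rw [mul_comm, Nat.mul_add_div j.pos, Nat.div_eq_of_lt j.2, add_zero]

theorem entry_mod (i : ℕ) (j : Fin n) : (i * n + j : ℕ) % n = j := by
  rw [Nat.mul_add_mod_self_right, Nat.mod_eq_of_lt j.2]

theorem entry_inj {i i' : ℕ} {j j' : Fin n} :
    i * n + j = i' * n + j' ↔ i = i' ∧ j = j' := by
  refine ⟨fun h => ⟨?_, Fin.ext ?_⟩, by rintro ⟨rfl, rfl⟩; rfl⟩
  · rw [← entry_div i j, h, entry_div]
  · rw [← entry_mod i j, h, entry_mod]

theorem matrixArray_entry (A : Matrix (Fin n) (Fin n) ℕ) (i j : Fin n) :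
    matrixArray A (i * n + j) = A i j := by
  simp only [matrixArray, entry_lt, dite_true, entry_div, entry_mod]

theorem matrixArray_of_le (A : Matrix (Fin n) (Fin n) ℕ) {k : ℕ} (hk : n * n ≤ k) :
    matrixArray A k = 0 :=
  dif_neg hk.not_gt

open Classical in
/-- The matrix with entries in `{0, 1}` that describes a relation. -/
noncomputable def relMatrix (R : Fin n → Fin n → Prop) : Matrix (Fin n) (Fin n) ℕ :=
  fun i j => if R i j then 1 else 0

variable {R S : Fin n → Fin n → Prop} {i j : Fin n}

theorem relMatrix_eq_zero_or_one (R : Fin n → Fin n → Prop) (i j : Fin n) :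
    relMatrix R i j = 0 ∨ relMatrix R i j = 1 := by
  rw [relMatrix]
  split_ifs <;> simp

theorem relMatrix_le_one (R : Fin n → Fin n → Prop) (i j : Fin n) : relMatrix R i j ≤ 1 := by
  rw [relMatrix]
  split_ifs <;> simp

theorem relMatrix_eq_zero : relMatrix R i j = 0 ↔ ¬ R i j := by
  simp [relMatrix]

theorem relMatrix_mul_relMatrix_eq_zero :
    (relMatrix R * relMatrix S) i j = 0 ↔ ¬ Relation.Comp R S i j := by
  simp [Matrix.mul_apply, relMatrix_eq_zero, Relation.Comp, or_iff_not_imp_left]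

theorem relMatrix_sub_relMatrix (R S : Fin n → Fin n → Prop) (i j : Fin n) :
    relMatrix R i j - relMatrix S i j = relMatrix (fun i j => R i j ∧ ¬ S i j) i j := by
  by_cases hR : R i j <;> by_cases hS : S i j <;> simp [relMatrix, hR, hS]

theorem matrixArray_relMatrix_insert (R : Fin n → Fin n → Prop) (x y : Fin n) :
    matrixArray (relMatrix fun i j => R i j ∨ i = x ∧ j = y) =
      Function.update (matrixArray (relMatrix R)) (x * n + y) 1 := by
  ext k
  rcases lt_or_ge k (n * n) with hk | hk
  · obtain ⟨i, j, rfl⟩ := exists_entry_eq hk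
    simp only [matrixArray_entry, Function.update_apply, entry_inj, Fin.val_inj, relMatrix]
    split_ifs <;> tauto
  · rw [Function.update_of_ne ((entry_lt x y).trans_le hk).ne', matrixArray_of_le _ hk,
      matrixArray_of_le _ hk]

theorem setArray_eq_zero {U : Set (Fin n)} : setArray U i = 0 ↔ i ∉ U := by
  simp [setArray, Fin.val_inj]

theorem setArray_empty : setArray (∅ : Set (Fin n)) = fun _ => 0 := by
  ext
  simp [setArray]

theorem setArray_insert (U : Set (Fin n)) (x : Fin n) :
    setArray (insert x U) = Function.update (setArray U) x 1 := by
  ext k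
  have hmem : (∃ u ∈ insert x U, (u : ℕ) = k) ↔ k = x ∨ ∃ u ∈ U, (u : ℕ) = k := by
    simp [eq_comm]
  simp only [setArray, Function.update_apply]
  split_ifs <;> simp_all only [true_or, or_true, or_self, iff_true, iff_false, not_true]

/-- The array that holds a list; all other positions hold `0`. -/
def listArray (l : List (Fin n)) (k : ℕ) : ℕ :=
  (l.map Fin.val).getD k 0

theorem listArray_eq {l : List (Fin n)} {k : ℕ} {x : Fin n} (h : l[k]? = some x) :
    listArray l k = x := by
  simp [listArray, h]

theorem listArray_append_singleton (l : List (Fin n)) (x : Fin n) :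
    listArray (l ++ [x]) = Function.update (listArray l) l.length x := by
  ext k
  simp only [listArray, List.map_append, List.map_cons, List.map_nil, Function.update_apply]
  grind

/-- The first `k` entries of an array, followed by zeros. -/
def truncate (k : ℕ) (f : ℕ → ℕ) (l : ℕ) : ℕ :=
  if l < k then f l else 0

theorem truncate_zero (f : ℕ → ℕ) : truncate 0 f = fun _ => 0 :=
  rfl

theorem truncate_succ (k : ℕ) (f : ℕ → ℕ) :
    truncate (k + 1) f = Function.update (truncate k f) k (f k) := by
  ext l
  simp only [truncate, Function.update_apply]
  grind

theorem truncate_matrixArray (A : Matrix (Fin n) (Fin n) ℕ) :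
    truncate (n * n) (matrixArray A) = matrixArray A := by
  ext k
  rw [truncate, ite_eq_left_iff, not_lt]
  exact fun hk => (matrixArray_of_le A hk).symm

end Encodings

section LowerBound

variable {B : ℕ} {p : Prog} {s s' : State} {t : ℕ}

theorem Exec.exists_card_le_eqOn (h : Exec B p s t s') (a : ℕ) :
    ∃ F : Finset ℕ, F.card ≤ t ∧ ∀ k ∉ F, s'.arr a k = s.arr a k := by
  induction h with
  | skip | const | arith | load | loop_done => exact ⟨∅, by simp, fun _ _ => rfl⟩
  | store b i x s =>
    refine ⟨{s.reg i}, by simp, fun k hk => ?_⟩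
    rw [Finset.mem_singleton] at hk
    rw [State.arr_setArr]
    split_ifs with hab
    · rw [hab, Function.update_of_ne hk]
    · rfl
  | seq _ _ ihp ihq | loop_step _ _ _ ihp ihq =>
    obtain ⟨F, hFcard, hF⟩ := ihp
    obtain ⟨E, hEcard, hE⟩ := ihq
    refine ⟨F ∪ E, (Finset.card_union_le _ _).trans (by omega), fun k hk => ?_⟩
    rw [Finset.notMem_union] at hk
    rw [hE k hk.2, hF k hk.1]
  | branch_true _ _ ih | branch_false _ _ ih =>
    obtain ⟨F, hFcard, hF⟩ := ih
    exact ⟨F, by omega, hF⟩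

-- The square of the all-ones matrix has no zero entry, so that all `n * n` entries of the array
-- for the product have to be written.
theorem MultipliesMatricesIn.mul_self_le {P : Prog} {M : ℕ → ℕ} (hP : MultipliesMatricesIn P M)
    (n : ℕ) : n * n ≤ M n := by
  obtain ⟨c, hP⟩ := hP
  obtain ⟨t, s, hexec, ht, hs⟩ := hP n (relMatrix ⊤) (relMatrix ⊤)
    (relMatrix_eq_zero_or_one _) (relMatrix_eq_zero_or_one _)
  obtain ⟨F, hFcard, hF⟩ := hexec.exists_card_le_eqOn 2
  have hrange : Finset.range (n * n) ⊆ F := by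
    intro k hk
    obtain ⟨i, j, rfl⟩ := exists_entry_eq (Finset.mem_range.1 hk)
    by_contra hkF
    have hzero : (relMatrix ⊤ * relMatrix ⊤ : Matrix (Fin n) (Fin n) ℕ) i j = 0 :=
      (hs i j).symm.trans (hF _ hkF)
    exact relMatrix_mul_relMatrix_eq_zero.1 hzero ⟨i, trivial, trivial⟩
  calc n * n = (Finset.range (n * n)).card := (Finset.card_range _).symm
    _ ≤ F.card := Finset.card_le_card hrange
    _ ≤ M n := hFcard.trans ht

end LowerBound

/-! ### Breadth-first search for the candidate -/

/-- The state of a breadth-first search: the vertices reached so far, each with the vertex from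
which it was reached, and the edges found so far, directed away from the vertex being explored. -/
structure Search (n : ℕ) where
  queue : List (Fin n × Fin n)
  found : Fin n → Fin n → Prop

namespace Search

variable {n : ℕ}

/-- The vertices reached so far, in the order of their discovery. -/
def vertices (S : Search n) : List (Fin n) :=
  S.queue.map Prod.fst

/-- The start of a search at `v`. As a convention, `v` is reached from itself. -/
def start (v : Fin n) : Search n where
  queue := [(v, v)]
  found := ⊥

open Classical in
/-- Record the edge from `x` to `y`. -/
noncomputable def add (S : Search n) (x y : Fin n) : Search n where
  queue := if y ∈ S.vertices then S.queue else S.queue ++ [(y, x)]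
  found a b := S.found a b ∨ a = x ∧ b = y

/-- The criterion for an edge from `x` to `y`, where `x` is at position `i` of the queue and was
reached from `p`. -/
def IsEdge (G : SimpleGraph (Fin n)) (U : Set (Fin n)) (S : Search n) (i : ℕ) (p x y : Fin n) :
    Prop :=
  if i = 0 then y ∈ U else y = p ∨ G.Adj p y ∧ G.Adj x y ∧ ¬ S.found p y

open Classical in
/-- Decide whether there is an edge from the vertex at position `i` of the queue to `y`. -/
noncomputable def step (G : SimpleGraph (Fin n)) (U : Set (Fin n)) (i : ℕ) (y : Fin n)
    (S : Search n) : Search n :=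
  match S.queue[i]? with
  | none => S
  | some (x, p) => if S.IsEdge G U i p x y then S.add x y else S

variable {G H : SimpleGraph (Fin n)} {v : Fin n} {U : Set (Fin n)} {S : Search n} {k : ℕ}
  {x y : Fin n} {i : ℕ}

theorem getElem?_queue_add {e : Fin n × Fin n} (h : S.queue[i]? = some e) (x y : Fin n) :
    (S.add x y).queue[i]? = some e := by
  simp only [add]
  split_ifs
  · exact h
  · rw [List.getElem?_append_left (List.getElem?_eq_some_iff.1 h).1, h]

theorem getElem?_queue_of_add {e : Fin n × Fin n} (h : (S.add x y).queue[i]? = some e) :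
    S.queue[i]? = some e ∨ i = S.queue.length ∧ e = (y, x) := by
  simp only [add] at h
  grind

theorem mem_vertices_iff : x ∈ S.vertices ↔ ∃ (i : ℕ) (p : Fin n), S.queue[i]? = some (x, p) := by
  simp [vertices, List.mem_iff_getElem?]

theorem mem_vertices_add (S : Search n) (x y : Fin n) {z : Fin n} :
    z ∈ (S.add x y).vertices ↔ z = y ∨ z ∈ S.vertices := by
  simp only [add, vertices]
  grind

theorem nodup_vertices_add (h : S.vertices.Nodup) (x y : Fin n) :
    (S.add x y).vertices.Nodup := by
  simp only [add, vertices] at h ⊢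
  grind

theorem nodup_vertices_step (h : S.vertices.Nodup) (G : SimpleGraph (Fin n)) (U : Set (Fin n))
    (i : ℕ) (y : Fin n) : (S.step G U i y).vertices.Nodup := by
  simp only [step]
  split
  · exact h
  · split_ifs
    exacts [nodup_vertices_add h _ _, h]

theorem length_queue_le (h : S.vertices.Nodup) : S.queue.length ≤ n := by
  simpa [vertices] using h.length_le_card

/-- A search from `v` has made `k` steps of the exploration of `H`; step `i * n + y` deals with
the edge from the vertex at position `i` of the queue to the vertex `y`. -/
structure Explores (H : SimpleGraph (Fin n)) (v : Fin n) (k : ℕ) (S : Search n) : Prop where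
  queue_zero : S.queue[0]? = some (v, v)
  parent {i : ℕ} {x p : Fin n} : S.queue[i]? = some (x, p) → i ≠ 0 →
    H.Adj p x ∧ ∃ i' < i, ∃ p', S.queue[i']? = some (p, p')
  sound {x y : Fin n} : S.found x y → H.Adj x y ∧ y ∈ S.vertices
  complete {i : ℕ} {x p y : Fin n} : S.queue[i]? = some (x, p) → i * n + y < k → H.Adj x y →
    S.found x y

theorem explores_start (H : SimpleGraph (Fin n)) (v : Fin n) : Explores H v 0 (start v) where
  queue_zero := rfl
  parent := by simp +contextual [start, List.getElem?_cons]
  sound := False.elim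
  complete _ h := absurd h (Nat.not_lt_zero _)

namespace Explores

theorem found_iff (hS : S.Explores H v k) {p : Fin n} (hx : S.queue[i]? = some (x, p))
    (hk : i * n + y < k) : S.found x y ↔ H.Adj x y :=
  ⟨fun h => (hS.sound h).1, hS.complete hx hk⟩

theorem isEdge_iff (hH : IsRootWithNbhd G v U H) {y p : Fin n}
    (hS : S.Explores H v (i * n + y)) (hx : S.queue[i]? = some (x, p)) :
    S.IsEdge G U i p x y ↔ H.Adj x y := by
  unfold IsEdge
  split_ifs with hi
  · subst hi
    obtain ⟨rfl, -⟩ := Prod.mk.inj (Option.some.inj (hx.symm.trans hS.queue_zero))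
    exact hH.2.2 ▸ Iff.rfl
  · obtain ⟨hpx, i', hi', p', hp⟩ := hS.parent hx hi
    have hlt : i' * n + y < i * n + y :=
      Nat.add_lt_add_right (Nat.mul_lt_mul_of_pos_right hi' y.pos) _
    rw [hH.adj_iff hpx, hS.found_iff hp hlt]

theorem add (hS : S.Explores H v k) {p : Fin n} (hx : S.queue[i]? = some (x, p))
    (hxy : H.Adj x y) (hk : k = i * n + y) : (S.add x y).Explores H v (k + 1) where
  queue_zero := getElem?_queue_add hS.queue_zero x y
  parent {j z q} hz hj := by
    rcases getElem?_queue_of_add hz with hz | ⟨rfl, heq⟩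
    · obtain ⟨hqz, i', hi', p', hq⟩ := hS.parent hz hj
      exact ⟨hqz, i', hi', p', getElem?_queue_add hq x y⟩
    · obtain ⟨rfl, rfl⟩ := Prod.mk.inj heq
      exact ⟨hxy, i, (List.getElem?_eq_some_iff.1 hx).1, p, getElem?_queue_add hx q z⟩
  sound := by
    rintro a b (h | ⟨rfl, rfl⟩)
    · exact ⟨(hS.sound h).1, (mem_vertices_add ..).2 (.inr (hS.sound h).2)⟩
    · exact ⟨hxy, (mem_vertices_add ..).2 (.inl rfl)⟩
  complete {j z q w} hz hw hzw := by
    rcases getElem?_queue_of_add hz with hold | ⟨rfl, -⟩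
    · rcases (Nat.lt_succ_iff.1 hw).lt_or_eq with hw | hw
      · exact .inl (hS.complete hold hw hzw)
      · obtain ⟨rfl, rfl⟩ := entry_inj.1 (hw.trans hk)
        exact .inr ⟨(Prod.mk.inj (Option.some.inj (hold.symm.trans hx))).1, rfl⟩
    · have hlt : (i + 1) * n ≤ S.queue.length * n :=
        Nat.mul_le_mul_right n (List.getElem?_eq_some_iff.1 hx).1
      linarith [y.isLt]

theorem step (hH : IsRootWithNbhd G v U H) {y : Fin n} (hS : S.Explores H v (i * n + y)) :
    (S.step G U i y).Explores H v (i * n + y + 1) := by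
  simp only [Search.step]
  split
  case h_1 hnone =>
    refine { hS with complete := fun {j z q w} hz hw hzw => hS.complete hz ?_ hzw }
    have hle : (j + 1) * n ≤ i * n := Nat.mul_le_mul_right n
      ((List.getElem?_eq_some_iff.1 hz).1.trans_le (List.getElem?_eq_none_iff.1 hnone))
    linarith [hw, w.isLt]
  case h_2 x p hx =>
    split_ifs with hedge
    · exact hS.add hx ((hS.isEdge_iff hH hx).1 hedge) rfl
    · refine { hS with complete := fun {j z q w} hz hw hzw => ?_ }
      rcases (Nat.lt_succ_iff.1 hw).lt_or_eq with hw | hw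
      · exact hS.complete hz hw hzw
      · obtain ⟨rfl, rfl⟩ := entry_inj.1 hw
        obtain ⟨rfl, -⟩ := Prod.mk.inj (Option.some.inj (hz.symm.trans hx))
        exact absurd ((hS.isEdge_iff hH hx).2 hzw) hedge

theorem found_eq_adj (hS : S.Explores H v (n * n)) (hnodup : S.vertices.Nodup)
    (hH : H.Connected) : S.found = H.Adj := by
  have hfound {x y : Fin n} (hx : x ∈ S.vertices) : S.found x y ↔ H.Adj x y := by
    obtain ⟨i, p, hx⟩ := mem_vertices_iff.1 hx
    have hi : i < n := (List.getElem?_eq_some_iff.1 hx).1.trans_le (length_queue_le hnodup)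
    exact hS.found_iff hx (entry_lt ⟨i, hi⟩ y)
  have hmem : ∀ x, x ∈ {x | x ∈ S.vertices} :=
    mem_of_connected_of_adj_closed hH (mem_vertices_iff.2 ⟨0, v, hS.queue_zero⟩)
      fun x hx y hxy => (hS.sound ((hfound hx).2 hxy)).2
  ext x y
  exact hfound (hmem x)

end Explores

end Search

section SearchProgram

variable {n B : ℕ} {G : SimpleGraph (Fin n)} {v : Fin n} {U : Set (Fin n)} {S : Search n}
  {s s' : State}

/-- The memory holds the instance `(G, v, U)`. -/
structure HoldsInstance (G : SimpleGraph (Fin n)) (v : Fin n) (U : Set (Fin n)) (s : State) :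
    Prop where
  size : s.reg 0 = n
  vertex : s.reg 1 = v
  graph : s.arr 0 = matrixArray (relMatrix G.Adj)
  nbhd : s.arr 1 = setArray U

theorem HoldsInstance.of_agreesOn (h : HoldsInstance G v U s) {K : Set ℕ}
    (hs : s'.AgreesOn K s) (hK : Set.Iio 2 ⊆ K) : HoldsInstance G v U s' where
  size := (hs.1 (hK (by simp))).trans h.size
  vertex := (hs.1 (hK (by simp))).trans h.vertex
  graph := (hs.2 (hK (by simp))).trans h.graph
  nbhd := (hs.2 (hK (by simp))).trans h.nbhd

@[simp] abbrev Reg.tail : ℕ := 6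
@[simp] abbrev Reg.explored : ℕ := 16
@[simp] abbrev Reg.parent : ℕ := 17
@[simp] abbrev Reg.cell : ℕ := 18
@[simp] abbrev Reg.parentCell : ℕ := 19
@[simp] abbrev Reg.entry : ℕ := 20
@[simp] abbrev Reg.aux : ℕ := 21

@[simp] abbrev Arr.graph : ℕ := 0
@[simp] abbrev Arr.nbhd : ℕ := 1
@[simp] abbrev Arr.root : ℕ := 2
@[simp] abbrev Arr.queue : ℕ := 3
@[simp] abbrev Arr.mark : ℕ := 4
@[simp] abbrev Arr.parent : ℕ := 5

/-- The memory holds the instance `(G, v, U)` and a candidate `R` for the adjacency of the root. -/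
structure HoldsCandidate (G : SimpleGraph (Fin n)) (v : Fin n) (U : Set (Fin n))
    (R : Fin n → Fin n → Prop) (s : State) : Prop extends HoldsInstance G v U s where
  root : s.arr Arr.root = matrixArray (relMatrix R)

theorem HoldsCandidate.of_agreesOn {R : Fin n → Fin n → Prop} (h : HoldsCandidate G v U R s)
    {K : Set ℕ} (hs : s'.AgreesOn K s) (hK : Set.Iio 3 ⊆ K) : HoldsCandidate G v U R s' where
  toHoldsInstance := h.toHoldsInstance.of_agreesOn hs ((Set.Iio_subset_Iio (by simp)).trans hK)
  root := (hs.2 (hK (by simp))).trans h.root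

/-- The memory holds the instance `(G, v, U)` and the search `S`. -/
structure HoldsSearch (G : SimpleGraph (Fin n)) (v : Fin n) (U : Set (Fin n)) (S : Search n)
    (s : State) : Prop extends HoldsCandidate G v U S.found s where
  tail : s.reg Reg.tail = S.queue.length
  queue : s.arr Arr.queue = listArray S.vertices
  mark : s.arr Arr.mark = setArray {x | x ∈ S.vertices}
  parent : s.arr Arr.parent = listArray (S.queue.map Prod.snd)

theorem HoldsSearch.of_agreesOn (h : HoldsSearch G v U S s) {K : Set ℕ}
    (hs : s'.AgreesOn K s) (hK : Set.Iio 7 ⊆ K) : HoldsSearch G v U S s' where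
  toHoldsCandidate := h.toHoldsCandidate.of_agreesOn hs ((Set.Iio_subset_Iio (by simp)).trans hK)
  tail := (hs.1 (hK (by simp))).trans h.tail
  queue := (hs.2 (hK (by simp))).trans h.queue
  mark := (hs.2 (hK (by simp))).trans h.mark
  parent := (hs.2 (hK (by simp))).trans h.parent

namespace Prog

/-- Set up the search at the vertex in register `1`. -/
def startSearch : Prog :=
  .const Reg.one 1 ;;
  .const Reg.aux 0 ;;
  .store Arr.mark 1 Reg.one ;;
  .store Arr.queue Reg.aux 1 ;;
  .store Arr.parent Reg.aux 1 ;;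
  .const Reg.tail 1

/-- Make `Reg.entry` nonzero iff the criterion for an edge from the explored vertex to the vertex
in `Reg.col` is met. -/
def testEdge : Prog :=
  .branch Reg.row
    (.load Reg.parent Arr.parent Reg.row ;;
      .arith .sub Reg.aux Reg.parent Reg.col ;;
      .arith .sub Reg.entry Reg.col Reg.parent ;;
      .arith .add Reg.aux Reg.aux Reg.entry ;;
      .branch Reg.aux
        (.arith .mul Reg.parentCell Reg.parent 0 ;;
          .arith .add Reg.parentCell Reg.parentCell Reg.col ;;
          .load Reg.entry Arr.graph Reg.parentCell ;;
          .load Reg.aux Arr.root Reg.parentCell ;;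
          .arith .sub Reg.entry Reg.entry Reg.aux ;;
          .load Reg.aux Arr.graph Reg.cell ;;
          .arith .mul Reg.entry Reg.entry Reg.aux)
        (.const Reg.entry 1))
    (.load Reg.entry Arr.nbhd Reg.col)

/-- Record the edge from the explored vertex to the vertex in `Reg.col`. -/
def recordEdge : Prog :=
  .store Arr.root Reg.cell Reg.one ;;
  .load Reg.aux Arr.mark Reg.col ;;
  .branch Reg.aux .skip
    (.store Arr.mark Reg.col Reg.one ;;
      .store Arr.queue Reg.tail Reg.col ;;
      .store Arr.parent Reg.tail Reg.explored ;;
      .arith .add Reg.tail Reg.tail Reg.one)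

/-- Load the vertex at position `Reg.row` of the queue. -/
def loadExplored : Prog :=
  .load Reg.explored Arr.queue Reg.row ;;
  .arith .mul Reg.cell Reg.explored 0 ;;
  .arith .add Reg.cell Reg.cell Reg.col

/-- Make the step of the search for the position `Reg.row` of the queue and the vertex in
`Reg.col`. -/
def searchStep : Prog :=
  .arith .sub Reg.aux Reg.tail Reg.row ;;
  .branch Reg.aux
    (loadExplored ;; testEdge ;; .branch Reg.entry recordEdge .skip)
    .skip

/-- Find all edges of the only candidate for the root. -/
def search : Prog :=
  startSearch ;; searchStep.forGrid

end Prog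

theorem Prog.runs_startSearch (hB : 1 < B) :
    Runs B startSearch (rootInput G v U) startSearch.cost
      (HoldsSearch G v U (Search.start v)) := by
  refine runs_of_wp ?_
  simp only [startSearch, wp]
  refine ⟨hB, by omega, hB, ?_⟩
  have hlist : Function.update (fun _ => 0) 0 (v : ℕ) = listArray [v] := by
    rw [← List.nil_append [v], listArray_append_singleton]
    rfl
  have hfound : matrixArray (relMatrix (Search.start v).found) = fun _ => 0 := by
    ext k
    simp [matrixArray, relMatrix, Search.start]
  have hmark : {x | x ∈ (Search.start v).vertices} = {v} := by
    ext
    simp [Search.start, Search.vertices]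
  refine { size := rfl, vertex := rfl, graph := rfl, nbhd := rfl, tail := rfl, root := hfound.symm,
           queue := hlist, mark := ?_, parent := hlist }
  rw [hmark, ← insert_empty_eq, setArray_insert, setArray_empty]
  rfl

variable {i j x p : Fin n}

/-- The search stored in the memory explores the vertex `x`, at position `i` of the queue, and
considers the vertex `j`. -/
structure ExploresAt (G : SimpleGraph (Fin n)) (v : Fin n) (U : Set (Fin n)) (S : Search n)
    (i j x : Fin n) (s : State) : Prop where
  grid : GridAt i j s
  search : HoldsSearch G v U S s
  explored : s.reg Reg.explored = x
  cell : s.reg Reg.cell = x * n + j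

theorem Prog.runs_loadExplored (hB : n * n < B) (hgrid : GridAt i j s)
    (hS : HoldsSearch G v U S s) (hx : S.queue[(i : ℕ)]? = some (x, p)) :
    Runs B loadExplored s loadExplored.cost (ExploresAt G v U S i j x) := by
  have hqueue : s.arr Arr.queue i = x := by
    rw [hS.queue]
    exact listArray_eq (by rw [Search.vertices, List.getElem?_map, hx, Option.map_some])
  have hcell := entry_lt x j
  refine ((runs_of_wp (Q := fun s' => s'.reg Reg.explored = x ∧ s'.reg Reg.cell = x * n + j)
    ?_).frame (K := Set.Iio 16) (by simp [loadExplored, writes])).mono le_rfl le_rfl ?_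
  · simp only [loadExplored, wp, Op.eval, Reg.explored, Reg.row, Reg.cell, Reg.col,
      State.reg_setReg, Nat.reduceEqDiff, ↓reduceIte, OfNat.zero_ne_ofNat, hgrid.row, hgrid.col,
      hgrid.size, hqueue, and_self, and_true]
    omega
  · rintro s' ⟨hagrees, hexplored, hcell⟩
    exact ⟨hgrid.of_agreesOn hagrees insert_gridRegs_subset,
      hS.of_agreesOn hagrees (Set.Iio_subset_Iio (by simp)), hexplored, hcell⟩

theorem Prog.runs_testEdge (hB : n * n < B) (hs : ExploresAt G v U S i j x s)
    (hx : S.queue[(i : ℕ)]? = some (x, p)) :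
    Runs B testEdge s testEdge.cost fun s' => ExploresAt G v U S i j x s' ∧
      (s'.reg Reg.entry = 0 ↔ ¬ S.IsEdge G U i p x j) := by
  have hparent : s.arr Arr.parent i = p := by
    rw [hs.search.parent]
    exact listArray_eq (by rw [List.getElem?_map, hx, Option.map_some])
  refine ((runs_of_wp (Q := fun s' => s'.reg Reg.entry = 0 ↔ ¬ S.IsEdge G U i p x j) ?_).frame
    (K := Set.Iio 17 ∪ {18}) (by simp [testEdge, writes])).mono le_rfl le_rfl ?_
  · simp only [testEdge, wp, Op.eval, Reg.row, Reg.parent, Reg.aux, Reg.col, Reg.entry,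
      Reg.parentCell, Reg.cell, State.reg_setReg, State.arr_setReg, Nat.reduceEqDiff, ↓reduceIte,
      Nat.succ_ne_self, OfNat.zero_ne_ofNat, one_ne_zero, Nat.add_eq_zero_iff, mul_eq_zero,
      false_iff, not_not, hs.grid.row, hs.grid.col, hs.grid.size, hparent, hs.cell, hs.search.nbhd,
      hs.search.graph, hs.search.root, matrixArray_entry]
    have hcell := entry_lt p j
    have hn := Nat.le_mul_self n
    split_ifs with hi hp
    · simp [Search.IsEdge, hi, setArray_eq_zero]
    · have hjp : j = p := Fin.ext (by omega)
      exact ⟨by omega, by omega, by omega, by omega, by simp [Search.IsEdge, hi, hjp]⟩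
    · have hjp : j ≠ p := by omega
      rw [relMatrix_sub_relMatrix]
      have hle := relMatrix_le_one (fun a b => G.Adj a b ∧ ¬ S.found a b) p j
      have hmul := Nat.mul_le_mul hle (relMatrix_le_one G.Adj x j)
      refine ⟨by omega, by omega, by omega, by omega, by omega, by omega, by omega, ?_⟩
      simp only [Search.IsEdge, hi, hjp, relMatrix_eq_zero, if_false, false_or]
      tauto
  · rintro s' ⟨hagrees, hentry⟩
    refine ⟨⟨hs.grid.of_agreesOn hagrees ?_, hs.search.of_agreesOn hagrees ?_,
      (hagrees.1 (by simp)).trans hs.explored, (hagrees.1 (by simp)).trans hs.cell⟩, hentry⟩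
    · exact insert_gridRegs_subset.trans
        ((Set.Iio_subset_Iio (by simp)).trans Set.subset_union_left)
    · exact (Set.Iio_subset_Iio (by simp)).trans Set.subset_union_left

theorem Prog.runs_recordEdge (hB : n + 1 < B) (hs : ExploresAt G v U S i j x s)
    (hnodup : S.vertices.Nodup) :
    Runs B recordEdge s recordEdge.cost (HoldsSearch G v U (S.add x j)) := by
  have hlength := Search.length_queue_le hnodup
  have hroot : matrixArray (relMatrix (S.add x j).found) =
      Function.update (s.arr Arr.root) (s.reg Reg.cell) (s.reg Reg.one) := by
    rw [hs.search.root, hs.cell, hs.grid.one]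
    exact matrixArray_relMatrix_insert S.found x j
  refine runs_of_wp ?_
  simp only [recordEdge, wp, Op.eval, Arr.root, Reg.cell, Reg.one, Reg.aux, Arr.mark, Reg.col,
    Arr.queue, Reg.tail, Arr.parent, Reg.explored, State.reg_setReg, State.reg_setArr,
    State.arr_setArr, Nat.reduceEqDiff, ↓reduceIte, hs.grid.col, hs.search.tail, hs.search.mark,
    setArray_eq_zero, Set.mem_ofPred_eq, ite_not]
  split_ifs with hj
  · have hqueue : (S.add x j).queue = S.queue := if_pos hj
    have hvertices : (S.add x j).vertices = S.vertices := congrArg (List.map Prod.fst) hqueue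
    constructor
    · exact ⟨⟨hs.search.size, hs.search.vertex, hs.search.graph, hs.search.nbhd⟩, hroot.symm⟩
    · simpa [hqueue] using hs.search.tail
    · simpa [hvertices] using hs.search.queue
    · simpa [hvertices] using hs.search.mark
    · simpa [hqueue] using hs.search.parent
  · have hqueue : (S.add x j).queue = S.queue ++ [(j, x)] := if_neg hj
    have hvertices : (S.add x j).vertices = S.vertices ++ [j] := by
      simp [Search.vertices, hqueue]
    have hcard : S.vertices.length = S.queue.length := List.length_map _
    have hset : {y | y ∈ S.vertices ++ [j]} = insert j {y | y ∈ S.vertices} := by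
      ext
      simp [or_comm]
    refine ⟨by rw [hs.grid.one]; omega, ?_⟩
    constructor
    · exact ⟨⟨hs.search.size, hs.search.vertex, hs.search.graph, hs.search.nbhd⟩, hroot.symm⟩
    · simp [hqueue, hs.grid.one]
    · simp [hvertices, hs.search.queue, hcard, listArray_append_singleton]
    · rw [hvertices, hset, setArray_insert]
      simp [hs.search.mark, hs.grid.one]
    · simp [hqueue, hs.search.parent, hs.explored, listArray_append_singleton]

theorem Prog.runs_searchStep (hB : n * n + 1 < B) (hgrid : GridAt i j s)
    (hS : HoldsSearch G v U S s) (hnodup : S.vertices.Nodup) :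
    Runs B searchStep s searchStep.cost (HoldsSearch G v U (S.step G U i j)) := by
  have hlength := Search.length_queue_le hnodup
  have hn := Nat.le_mul_self n
  have hskip {s' : State} {S' : Search n} (hs' : HoldsSearch G v U S' s') :
      Runs B .skip s' 1 (HoldsSearch G v U S') :=
    runs_of_wp (p := .skip) hs'
  have hguard : Runs B (.arith .sub Reg.aux Reg.tail Reg.row) s 1 fun s' =>
      s'.AgreesOn (Set.Iio 16) s ∧ s'.reg Reg.aux = S.queue.length - i := by
    refine (runs_of_wp ?_).frame (by simp [writes])
    simp only [wp, Op.eval, Reg.tail, hS.tail, Reg.row, hgrid.row, Reg.aux, State.reg_setReg,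
      ↓reduceIte, and_true]
    omega
  refine hguard.seq fun s hs => ?_
  have hgrid := hgrid.of_agreesOn hs.1 insert_gridRegs_subset
  have hS := hS.of_agreesOn hs.1 (Set.Iio_subset_Iio (by simp))
  refine Runs.branch (fun haux => ?_) fun haux => hskip ?_
  · have hi : i < S.queue.length := by omega
    obtain ⟨⟨x, p⟩, hx⟩ : ∃ e, S.queue[(i : ℕ)]? = some e := ⟨_, List.getElem?_eq_getElem hi⟩
    refine (runs_loadExplored (by omega) hgrid hS hx).seq fun s hs => ?_
    refine (runs_testEdge (by omega) hs hx).seq fun s hs => ?_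
    refine Runs.branch (fun hentry => ?_) fun hentry => hskip ?_
    · have hedge : S.IsEdge G U i p x j := by rwa [ne_eq, hs.2, not_not] at hentry
      simpa only [Search.step, hx, if_pos hedge] using runs_recordEdge (by omega) hs.1 hnodup
    · simpa only [Search.step, hx, if_neg (hs.2.1 hentry)] using hs.1.search
  · have hi : S.queue.length ≤ i := by omega
    simpa only [Search.step, List.getElem?_eq_none hi] using hS

/-- The memory holds the instance `(G, v, U)` and a search that has made `k` steps of the
exploration of every root. -/
def SearchInvariant (G : SimpleGraph (Fin n)) (v : Fin n) (U : Set (Fin n)) (k : ℕ) (s : State) :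
    Prop :=
  ∃ S : Search n, HoldsSearch G v U S s ∧ S.vertices.Nodup ∧
    ∀ H, IsRootWithNbhd G v U H → S.Explores H v k

theorem Prog.runs_search (hB : n * n + 1 < B) (hG : G.Connected) :
    Runs B search (rootInput G v U) (startSearch.cost + (n * n * (searchStep.cost + 5) + 4))
      fun s => ∃ R, HoldsCandidate G v U R s ∧ ∀ H, IsRootWithNbhd G v U H → H.Adj = R := by
  have hstart (s : State) (hs : HoldsSearch G v U (Search.start v) s) :
      SearchInvariant G v U 0 s :=
    ⟨_, hs, List.nodup_singleton v, fun H _ => Search.explores_start H v⟩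
  have hB' : 1 < B := by omega
  refine ((runs_startSearch hB').seq fun s hs => Runs.forGrid (I := SearchInvariant G v U) hB ?_
    ?_ ?_ hs.size (hstart s hs)).mono le_rfl le_rfl ?_
  · simp [searchStep, loadExplored, testEdge, recordEdge, writes, gridRegs]
  · rintro k s s' hagrees ⟨S, hS, hinv⟩
    exact ⟨S, hS.of_agreesOn hagrees fun x hx hgrid =>
      absurd (hgrid.1.trans_lt hx) (by simp), hinv⟩
  · rintro i j s hgrid ⟨S, hS, hnodup, hexplores⟩
    refine (runs_searchStep hB hgrid hS hnodup).mono le_rfl le_rfl fun s' hs' => ?_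
    exact ⟨_, hs', Search.nodup_vertices_step hnodup G U i j,
      fun H hH => (hexplores H hH).step hH⟩
  · rintro s ⟨S, hS, hnodup, hexplores⟩
    exact ⟨S.found, hS.toHoldsCandidate, fun H hH =>
      ((hexplores H hH).found_eq_adj hnodup (hH.connected hG)).symm⟩

end SearchProgram

/-! ### Verification of the candidate -/

section Verification

variable {n B T : ℕ} {G : SimpleGraph (Fin n)} {v : Fin n} {U : Set (Fin n)}
  {R : Fin n → Fin n → Prop} {s s' : State} {P : Prog}

/-- Two disjoint parts of the memory, for `k = 0` and `k = 1`, which leave the names below `100`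
free. -/
def slot (k x : ℕ) : ℕ :=
  2 * x + k + 100

theorem slot_injective (k : ℕ) : (slot k).Injective := fun x y h => by
  simp only [slot] at h
  omega

theorem range_slot_subset (k : ℕ) : Set.range (slot k) ⊆ Set.Ici 100 := by
  rintro _ ⟨x, rfl⟩
  exact Nat.le_add_left 100 _

theorem notMem_range_slot {x : ℕ} (hx : x < 100) (k : ℕ) : x ∉ Set.range (slot k) :=
  fun h => (range_slot_subset k h).not_gt hx

theorem slot_zero_notMem (x : ℕ) : slot 0 x ∉ Set.range (slot 1) := by
  rintro ⟨y, h⟩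
  simp only [slot] at h
  omega

theorem slot_one_notMem (x : ℕ) : slot 1 x ∉ Set.range (slot 0) := by
  rintro ⟨y, h⟩
  simp only [slot] at h
  omega

theorem view_slot_setReg {x : ℕ} (hx : x < 100) (k m : ℕ) (s : State) :
    (s.setReg x m).view (slot k) = s.view (slot k) :=
  State.view_setReg_of_notMem (notMem_range_slot hx k) s m

/-- The memory with `n` in register `0`, the contents `f` in the arrays `0` and `1`, and `0`
elsewhere. -/
def squareInput (n : ℕ) (f : ℕ → ℕ) : State where
  reg x := if x = 0 then n else 0
  arr a := if a = 0 then f else if a = 1 then f else fun _ => 0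

theorem squareInput_matrixArray (A : Matrix (Fin n) (Fin n) ℕ) :
    squareInput n (matrixArray A) = mulInput A A :=
  rfl

theorem squareInput_setReg (f : ℕ → ℕ) (m : ℕ) :
    (squareInput n f).setReg 0 m = squareInput m f := by
  refine congrArg₂ State.mk (funext fun x => ?_) rfl
  rcases x with _ | x <;> simp [squareInput]

theorem squareInput_setArr_setArr (f : ℕ → ℕ) (m w : ℕ) :
    ((squareInput n f).setArr 0 m w).setArr 1 m w = squareInput n (Function.update f m w) := by
  refine congrArg₂ State.mk rfl (funext fun a => ?_)
  rcases a with _ | _ | a <;> simp [squareInput, State.setArr]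

theorem view_slot_rootInput (k : ℕ) :
    (rootInput G v U).view (slot k) = squareInput 0 fun _ => 0 := by
  simp [State.view, rootInput, squareInput, slot]

@[simp] abbrev Reg.accept : ℕ := 7
@[simp] abbrev Reg.transposed : ℕ := 22
@[simp] abbrev Reg.graph : ℕ := 23
@[simp] abbrev Reg.nbhd : ℕ := 24
@[simp] abbrev Reg.square : ℕ := 25
@[simp] abbrev Reg.squareRest : ℕ := 26
@[simp] abbrev Reg.offDiagonal : ℕ := 27
@[simp] abbrev Reg.offVertex : ℕ := 28

namespace Prog

/-- Copy `Reg.aux` to the position `Reg.pos` of both factors of a product. -/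
def storeFactors (k : ℕ) : Prog :=
  .store (slot k 0) Reg.pos Reg.aux ;;
  .store (slot k 1) Reg.pos Reg.aux

/-- Copy the entries at the position `Reg.pos` to the factors of the two products. -/
def stageStep : Prog :=
  .load Reg.aux Arr.root Reg.pos ;;
  storeFactors 0 ;;
  .load Reg.graph Arr.graph Reg.pos ;;
  .arith .sub Reg.aux Reg.graph Reg.aux ;;
  storeFactors 1

/-- Set up the multiplications. -/
def stage : Prog :=
  (.const Reg.aux 0 ;;
    .arith .add (slot 0 0) 0 Reg.aux ;;
    .arith .add (slot 1 0) 0 Reg.aux) ;;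
  stageStep.forGrid

end Prog

/-- The memory holds a candidate `R` for the root and, in the two slots, the first `k` entries of
the factors of the products that are needed to verify it. -/
structure HoldsFactors (G : SimpleGraph (Fin n)) (v : Fin n) (U : Set (Fin n))
    (R : Fin n → Fin n → Prop) (k : ℕ) (s : State) : Prop extends HoldsCandidate G v U R s where
  root_factors : s.view (slot 0) = squareInput n (truncate k (matrixArray (relMatrix R)))
  rest_factors : s.view (slot 1) =
    squareInput n (truncate k (matrixArray (relMatrix fun x y => G.Adj x y ∧ ¬ R x y)))

theorem HoldsFactors.of_agreesOn {k : ℕ} (h : HoldsFactors G v U R k s) {K : Set ℕ}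
    (hs : s'.AgreesOn K s) (hK : Set.Iio 3 ∪ Set.Ici 100 ⊆ K) : HoldsFactors G v U R k s' where
  toHoldsCandidate := h.toHoldsCandidate.of_agreesOn hs (Set.subset_union_left.trans hK)
  root_factors := (hs.mono ((range_slot_subset 0).trans
    (Set.subset_union_right.trans hK))).view_eq.trans h.root_factors
  rest_factors := (hs.mono ((range_slot_subset 1).trans
    (Set.subset_union_right.trans hK))).view_eq.trans h.rest_factors

theorem Prog.runs_stageStep (hB : 1 < B) {i j : Fin n} (hgrid : GridAt i j s)
    (hs : HoldsFactors G v U R (i * n + j) s) :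
    Runs B stageStep s stageStep.cost (HoldsFactors G v U R (i * n + j + 1)) := by
  have hne {x : ℕ} (hx : x < 100) (k y : ℕ) : x ≠ slot k y :=
    fun h => notMem_range_slot hx k ⟨y, h.symm⟩
  refine ((runs_of_wp (Q := fun s' =>
    s'.view (slot 0) = squareInput n (truncate (i * n + j + 1) (matrixArray (relMatrix R))) ∧
    s'.view (slot 1) = squareInput n (truncate (i * n + j + 1)
      (matrixArray (relMatrix fun x y => G.Adj x y ∧ ¬ R x y)))) ?_).frame (K := Set.Iio 3)
    ?_).mono le_rfl le_rfl ?_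
  · simp [stageStep, storeFactors, wp, Op.eval, hgrid.pos, hs.root, hs.graph, hne,
      matrixArray_entry, (relMatrix_le_one _ _ _).trans_lt hB, view_slot_setReg,
      State.view_setArr_of_notMem (slot_zero_notMem _),
      State.view_setArr_of_notMem (slot_one_notMem _),
      State.view_setArr (slot_injective _), hs.root_factors, hs.rest_factors,
      squareInput_setArr_setArr, truncate_succ, relMatrix_sub_relMatrix]
  · simp [stageStep, storeFactors, writes, slot]
  · rintro s' ⟨hagrees, hroot, hrest⟩
    exact ⟨hs.toHoldsCandidate.of_agreesOn hagrees le_rfl, hroot, hrest⟩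

theorem Prog.runs_stage (hB : n * n + 1 < B) (hs : HoldsCandidate G v U R s)
    (hslot : ∀ k, s.view (slot k) = squareInput 0 fun _ => 0) :
    Runs B stage s (n * n * (stageStep.cost + 5) + 7) (HoldsFactors G v U R (n * n)) := by
  have hn := Nat.le_mul_self n
  have hinit : Runs B (.const Reg.aux 0 ;; .arith .add (slot 0 0) 0 Reg.aux ;;
      .arith .add (slot 1 0) 0 Reg.aux) s 3 (HoldsFactors G v U R 0) := by
    have h0 : 0 ≠ slot 0 0 := by simp [slot]
    have h21 : 21 ≠ slot 0 0 := by simp [slot]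
    have hB' : 0 < B ∧ n < B := by omega
    refine ((runs_of_wp (Q := fun s' => s'.view (slot 0) = squareInput n (fun _ => 0) ∧
      s'.view (slot 1) = squareInput n fun _ => 0) ?_).frame (K := Set.Iio 3) ?_).mono
      le_rfl le_rfl ?_
    · simp [wp, Op.eval, hs.size, hB', h0, h21, view_slot_setReg,
        State.view_setReg_of_notMem (slot_zero_notMem _),
        State.view_setReg_of_notMem (slot_one_notMem _), State.view_setReg (slot_injective _),
        hslot, squareInput_setReg]
    · simp [writes, slot]
    · rintro s' ⟨hagrees, hroot, hrest⟩
      exact ⟨hs.of_agreesOn hagrees le_rfl, by rwa [truncate_zero], by rwa [truncate_zero]⟩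
  refine (hinit.seq fun s hs => Runs.forGrid (I := HoldsFactors G v U R)
    (c := stageStep.cost) hB ?_ ?_ ?_ hs.size hs).mono le_rfl (by omega) fun s hs => hs
  · simp [stageStep, storeFactors, writes, gridRegs, slot]
  · exact fun k s s' hagrees hs => hs.of_agreesOn hagrees subset_gridRegs_compl
  · exact fun i j s hgrid hs => runs_stageStep (by omega) hgrid hs

/-- The program `P` squares any `n × n` matrix with entries in `{0, 1}` in at most `T` steps, on
numbers smaller than `B`. -/
def SquaresIn (n B : ℕ) (P : Prog) (T : ℕ) : Prop :=
  ∀ A : Matrix (Fin n) (Fin n) ℕ, (∀ i j, A i j = 0 ∨ A i j = 1) →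
    Runs B P (mulInput A A) T fun s => ∀ i j : Fin n, s.arr 2 (i * n + j) = (A * A) i j

/-- The memory holds a candidate `R` for the root and the two squares that are needed to verify
it. -/
structure HoldsSquares (G : SimpleGraph (Fin n)) (v : Fin n) (U : Set (Fin n))
    (R : Fin n → Fin n → Prop) (s : State) : Prop extends HoldsCandidate G v U R s where
  root_square : ∀ i j : Fin n, s.arr (slot 0 2) (i * n + j) = (relMatrix R * relMatrix R) i j
  rest_square : ∀ i j : Fin n, s.arr (slot 1 2) (i * n + j) =
    ((relMatrix fun x y => G.Adj x y ∧ ¬ R x y) * relMatrix fun x y => G.Adj x y ∧ ¬ R x y) i j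

theorem HoldsSquares.of_agreesOn (h : HoldsSquares G v U R s) {K : Set ℕ}
    (hs : s'.AgreesOn K s) (hK : Set.Iio 3 ∪ Set.Ici 100 ⊆ K) : HoldsSquares G v U R s' where
  toHoldsCandidate := h.toHoldsCandidate.of_agreesOn hs (Set.subset_union_left.trans hK)
  root_square := by
    rw [hs.2 (hK (Or.inr (range_slot_subset 0 ⟨2, rfl⟩)))]
    exact h.root_square
  rest_square := by
    rw [hs.2 (hK (Or.inr (range_slot_subset 1 ⟨2, rfl⟩)))]
    exact h.rest_square

theorem SquaresIn.runs_rename (hP : SquaresIn n B P T) {k : ℕ} {R : Fin n → Fin n → Prop}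
    (hs : s.view (slot k) = squareInput n (truncate (n * n) (matrixArray (relMatrix R)))) :
    Runs B (P.rename (slot k)) s T fun s' => s'.AgreesOn (Set.range (slot k))ᶜ s ∧
      ∀ i j : Fin n, s'.arr (slot k 2) (i * n + j) = (relMatrix R * relMatrix R) i j := by
  refine Runs.rename (Q := fun s => ∀ i j : Fin n, s.arr 2 (i * n + j) =
    (relMatrix R * relMatrix R) i j) (slot_injective k) ?_
  rw [hs, truncate_matrixArray, squareInput_matrixArray]
  exact hP _ (relMatrix_eq_zero_or_one R)

theorem SquaresIn.runs_squares (hP : SquaresIn n B P T) (hs : HoldsFactors G v U R (n * n) s) :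
    Runs B (P.rename (slot 0) ;; P.rename (slot 1)) s (T + T) (HoldsSquares G v U R) := by
  have hsmall (k : ℕ) : Set.Iio 3 ⊆ (Set.range (slot k))ᶜ := fun x hx =>
    notMem_range_slot (lt_trans hx (by simp)) k
  refine (hP.runs_rename hs.root_factors).seq fun s₁ hs₁ => ?_
  have hrest : s₁.view (slot 1) = s.view (slot 1) :=
    (hs₁.1.mono (Set.range_subset_iff.2 slot_one_notMem)).view_eq
  refine (hP.runs_rename (hrest.trans hs.rest_factors)).mono le_rfl le_rfl fun s₂ hs₂ => ?_
  refine ⟨(hs.toHoldsCandidate.of_agreesOn hs₁.1 (hsmall 0)).of_agreesOn hs₂.1 (hsmall 1), ?_,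
    hs₂.2⟩
  rw [hs₂.1.2 (slot_zero_notMem 2)]
  exact hs₁.2

namespace Prog

/-- Load the data for the verification of the entry at the position `Reg.pos`. -/
def loadEntry : Prog :=
  .load Reg.entry Arr.root Reg.pos ;;
  .arith .mul Reg.transposed Reg.col 0 ;;
  .arith .add Reg.transposed Reg.transposed Reg.row ;;
  .load Reg.transposed Arr.root Reg.transposed ;;
  .load Reg.graph Arr.graph Reg.pos ;;
  .load Reg.nbhd Arr.nbhd Reg.col ;;
  .load Reg.square (slot 0 2) Reg.pos ;;
  .load Reg.squareRest (slot 1 2) Reg.pos ;;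
  .arith .sub Reg.aux Reg.row Reg.col ;;
  .arith .sub Reg.offDiagonal Reg.col Reg.row ;;
  .arith .add Reg.offDiagonal Reg.aux Reg.offDiagonal ;;
  .arith .sub Reg.aux Reg.row 1 ;;
  .arith .sub Reg.offVertex 1 Reg.row ;;
  .arith .add Reg.offVertex Reg.aux Reg.offVertex

def reject : Prog :=
  .const Reg.accept 0

/-- Verify `Passes.edge` for the loaded entry. -/
def checkEdge : Prog :=
  .branch Reg.entry
    (.branch Reg.transposed
      (.branch Reg.square reject (.branch Reg.squareRest reject .skip))
      reject)
    .skip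

/-- Verify `Passes.nbhd` for the loaded entry. -/
def checkNbhd : Prog :=
  .branch Reg.offVertex .skip
    (.branch Reg.entry (.branch Reg.nbhd .skip reject) (.branch Reg.nbhd reject .skip))

/-- Verify `Passes.square` for the loaded entry. -/
def checkSquare : Prog :=
  .branch Reg.offDiagonal
    (.branch Reg.graph
      (.branch Reg.entry .skip (.branch Reg.square .skip reject))
      (.branch Reg.entry reject (.branch Reg.square reject .skip)))
    .skip

/-- Verify the entry at the position `Reg.pos`. -/
def checkEntry : Prog :=
  loadEntry ;; checkEdge ;; checkNbhd ;; checkSquare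

/-- Verify the candidate by means of two multiplications with `P`, and put the verdict into
register `0`. -/
def verify (P : Prog) : Prog :=
  stage ;; (P.rename (slot 0) ;; P.rename (slot 1)) ;; .const Reg.accept 1 ;;
    checkEntry.forGrid ;; .branch Reg.accept (.const 0 1) (.const 0 0)

end Prog

variable {i j : Fin n}

/-- The memory holds the data for the verification of the entry `(i, j)` of the candidate `R`. -/
structure HoldsEntry (G : SimpleGraph (Fin n)) (v : Fin n) (U : Set (Fin n))
    (R : Fin n → Fin n → Prop) (i j : Fin n) (s : State) : Prop where
  entry : s.reg Reg.entry = 0 ↔ ¬ R i j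
  transposed : s.reg Reg.transposed = 0 ↔ ¬ R j i
  graph : s.reg Reg.graph = 0 ↔ ¬ G.Adj i j
  nbhd : s.reg Reg.nbhd = 0 ↔ j ∉ U
  square : s.reg Reg.square = 0 ↔ ¬ Relation.Comp R R i j
  squareRest : s.reg Reg.squareRest = 0 ↔
    ¬ Relation.Comp (fun a b => G.Adj a b ∧ ¬ R a b) (fun a b => G.Adj a b ∧ ¬ R a b) i j
  offDiagonal : s.reg Reg.offDiagonal = 0 ↔ i = j
  offVertex : s.reg Reg.offVertex = 0 ↔ i = v

theorem HoldsEntry.of_agreesOn (h : HoldsEntry G v U R i j s)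
    (hs : s'.AgreesOn {Reg.accept}ᶜ s) : HoldsEntry G v U R i j s' where
  entry := by rw [hs.1 (by simp)]; exact h.entry
  transposed := by rw [hs.1 (by simp)]; exact h.transposed
  graph := by rw [hs.1 (by simp)]; exact h.graph
  nbhd := by rw [hs.1 (by simp)]; exact h.nbhd
  square := by rw [hs.1 (by simp)]; exact h.square
  squareRest := by rw [hs.1 (by simp)]; exact h.squareRest
  offDiagonal := by rw [hs.1 (by simp)]; exact h.offDiagonal
  offVertex := by rw [hs.1 (by simp)]; exact h.offVertex

theorem Prog.runs_loadEntry (hB : n * n < B) (hgrid : GridAt i j s)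
    (hs : HoldsSquares G v U R s) :
    Runs B loadEntry s loadEntry.cost fun s' =>
      s'.AgreesOn (Set.Iio 20 ∪ Set.Ici 100) s ∧ HoldsEntry G v U R i j s' := by
  have hcell := entry_lt j i
  have hn := Nat.le_mul_self n
  refine (runs_of_wp ?_).frame (by simp [loadEntry, writes])
  simp only [loadEntry, wp, Op.eval, Reg.entry, Arr.root, Reg.pos, Reg.transposed, Reg.col, Reg.row,
    Reg.graph, Arr.graph, Reg.nbhd, Arr.nbhd, Reg.square, Reg.squareRest, Reg.aux, Reg.offDiagonal,
    Reg.offVertex, State.reg_setReg, State.arr_setReg, Nat.reduceEqDiff, ↓reduceIte,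
    OfNat.zero_ne_ofNat, OfNat.one_ne_ofNat, hgrid.pos, hgrid.row, hgrid.col, hs.size, hs.vertex,
    hs.root, hs.graph, hs.nbhd, hs.root_square, hs.rest_square, matrixArray_entry]
  refine ⟨by omega, by omega, by omega, by omega, by omega, by omega, by omega, by omega, ?_⟩
  constructor <;> simp [relMatrix_eq_zero, relMatrix_mul_relMatrix_eq_zero, setArray_eq_zero]
  · omega
  · omega

theorem HoldsEntry.runs_checkEdge (hB : 0 < B) (hs : HoldsEntry G v U R i j s) :
    Runs B Prog.checkEdge s Prog.checkEdge.cost fun s' => s'.AgreesOn {Reg.accept}ᶜ s ∧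
      (s'.reg Reg.accept ≠ 0 ↔ s.reg Reg.accept ≠ 0 ∧ (R i j → R j i ∧ ¬ Relation.Comp R R i j ∧
        ¬ Relation.Comp (fun a b => G.Adj a b ∧ ¬ R a b)
          (fun a b => G.Adj a b ∧ ¬ R a b) i j)) := by
  refine (Prog.runs_of_wp ?_).frame (by simp [Prog.checkEdge, Prog.reject, Prog.writes])
  classical
  simp only [Prog.checkEdge, Prog.reject, Prog.wp, hs.entry, hs.transposed, hs.square,
    hs.squareRest]
  split_ifs <;> simp_all

theorem HoldsEntry.runs_checkNbhd (hB : 0 < B) (hs : HoldsEntry G v U R i j s) :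
    Runs B Prog.checkNbhd s Prog.checkNbhd.cost fun s' => s'.AgreesOn {Reg.accept}ᶜ s ∧
      (s'.reg Reg.accept ≠ 0 ↔ s.reg Reg.accept ≠ 0 ∧ (i = v → (R i j ↔ j ∈ U))) := by
  refine (Prog.runs_of_wp ?_).frame (by simp [Prog.checkNbhd, Prog.reject, Prog.writes])
  classical
  simp only [Prog.checkNbhd, Prog.reject, Prog.wp, hs.entry, hs.nbhd, hs.offVertex]
  split_ifs <;> simp_all

theorem HoldsEntry.runs_checkSquare (hB : 0 < B) (hs : HoldsEntry G v U R i j s) :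
    Runs B Prog.checkSquare s Prog.checkSquare.cost fun s' => s'.AgreesOn {Reg.accept}ᶜ s ∧
      (s'.reg Reg.accept ≠ 0 ↔
        s.reg Reg.accept ≠ 0 ∧ (i ≠ j → (G.Adj i j ↔ R i j ∨ Relation.Comp R R i j))) := by
  refine (Prog.runs_of_wp ?_).frame (by simp [Prog.checkSquare, Prog.reject, Prog.writes])
  classical
  simp only [Prog.checkSquare, Prog.reject, Prog.wp, hs.entry, hs.graph, hs.square,
    hs.offDiagonal]
  split_ifs <;> simp_all

theorem Prog.runs_checkEntry (hB : n * n < B) (hgrid : GridAt i j s)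
    (hs : HoldsSquares G v U R s) :
    Runs B checkEntry s checkEntry.cost fun s' => HoldsSquares G v U R s' ∧
      (s'.reg Reg.accept ≠ 0 ↔ s.reg Reg.accept ≠ 0 ∧ Passes G v U R i j) := by
  have hB' : 0 < B := by omega
  refine (runs_loadEntry hB hgrid hs).seq fun s₁ ⟨h₁, hentry⟩ => ?_
  refine (hentry.runs_checkEdge hB').seq fun s₂ ⟨h₂, hedge⟩ => ?_
  refine ((hentry.of_agreesOn h₂).runs_checkNbhd hB').seq fun s₃ ⟨h₃, hnbhd⟩ => ?_
  refine (((hentry.of_agreesOn h₂).of_agreesOn h₃).runs_checkSquare hB').mono le_rfl le_rfl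
    fun s₄ ⟨h₄, hsquare⟩ => ⟨?_, ?_⟩
  · have hkeep : Set.Iio 3 ∪ Set.Ici 100 ⊆ ({Reg.accept}ᶜ : Set ℕ) := by
      rintro x (hx | hx) rfl <;> simp at hx
    exact (hs.of_agreesOn h₁ (Set.union_subset_union_left _
      (Set.Iio_subset_Iio (by simp)))).of_agreesOn ((h₄.trans h₃).trans h₂) hkeep
  · rw [hsquare, hnbhd, hedge, h₁.1 (by simp), passes_iff, and_assoc, and_assoc, and_assoc]

/-- The memory holds the squares for the verification of the candidate `R`, and no entry before
the position `k` led to a rejection iff all of them pass. -/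
structure CheckInvariant (G : SimpleGraph (Fin n)) (v : Fin n) (U : Set (Fin n))
    (R : Fin n → Fin n → Prop) (k : ℕ) (s : State) : Prop extends HoldsSquares G v U R s where
  accept : s.reg Reg.accept ≠ 0 ↔ ∀ x y : Fin n, (x * n + y : ℕ) < k → Passes G v U R x y

theorem CheckInvariant.succ (h : CheckInvariant G v U R (i * n + j) s)
    (hs : HoldsSquares G v U R s')
    (haccept : s'.reg Reg.accept ≠ 0 ↔ s.reg Reg.accept ≠ 0 ∧ Passes G v U R i j) :
    CheckInvariant G v U R (i * n + j + 1) s' where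
  toHoldsSquares := hs
  accept := by
    rw [haccept, h.accept]
    refine ⟨fun h x y hxy => ?_, fun h =>
      ⟨fun x y hxy => h x y (Nat.lt_succ_of_lt hxy), h i j (Nat.lt_succ_self _)⟩⟩
    obtain hlt | heq := Nat.lt_succ_iff_lt_or_eq.1 hxy
    · exact h.1 x y hlt
    · obtain ⟨hxi, rfl⟩ := entry_inj.1 heq
      rw [Fin.ext hxi]
      exact h.2

theorem Prog.runs_verify (hB : n * n + 1 < B) (hP : SquaresIn n B P T)
    (hs : HoldsCandidate G v U R s)
    (hslot : ∀ k, s.view (slot k) = squareInput 0 fun _ => 0) :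
    Runs B (verify P) s (n * n * (stageStep.cost + checkEntry.cost + 10) + 2 * T + 14) fun s' =>
      s'.arr Arr.root = matrixArray (relMatrix R) ∧
      ((∃ H, IsRootWithNbhd G v U H ∧ H.Adj = R) → s'.reg 0 = 1) ∧
      ((¬ ∃ H, IsRootWithNbhd G v U H ∧ H.Adj = R) → s'.reg 0 = 0) := by
  have haccept (s : State) (hs : HoldsSquares G v U R s) :
      Runs B (.const Reg.accept 1) s 1 (CheckInvariant G v U R 0) := by
    refine runs_of_wp (p := .const Reg.accept 1) ⟨by omega, ?_⟩
    refine ⟨hs.of_agreesOn (State.agreesOn_setReg (by simp) s 1) le_rfl, by simp⟩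
  have hcheck (s : State) (hs : CheckInvariant G v U R 0 s) :
      Runs B checkEntry.forGrid s (n * n * (checkEntry.cost + 5) + 4)
        (CheckInvariant G v U R (n * n)) := by
    refine Runs.forGrid hB (by simp [checkEntry, loadEntry, checkEdge, checkNbhd, checkSquare,
      reject, writes, gridRegs]) (fun k s s' hagrees hs => ?_) (fun i j s hgrid hs => ?_)
      hs.size hs
    · refine ⟨hs.toHoldsSquares.of_agreesOn hagrees subset_gridRegs_compl, ?_⟩
      rw [hagrees.1 (by simp [gridRegs])]
      exact hs.accept
    · exact (runs_checkEntry (by omega) hgrid hs.toHoldsSquares).mono le_rfl le_rfl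
        fun s' hs' => hs.succ hs'.1 hs'.2
  have hverdict (s : State) (hs : CheckInvariant G v U R (n * n) s) :
      Runs B (.branch Reg.accept (.const 0 1) (.const 0 0)) s 2 fun s' =>
        s'.arr Arr.root = matrixArray (relMatrix R) ∧
        ((∃ H, IsRootWithNbhd G v U H ∧ H.Adj = R) → s'.reg 0 = 1) ∧
        ((¬ ∃ H, IsRootWithNbhd G v U H ∧ H.Adj = R) → s'.reg 0 = 0) := by
    have hall : s.reg Reg.accept ≠ 0 ↔ ∃ H, IsRootWithNbhd G v U H ∧ H.Adj = R := by
      rw [hs.accept, ← forall_passes_iff]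
      exact forall₂_congr fun x y => imp_iff_right (entry_lt x y)
    refine runs_of_wp (p := .branch Reg.accept (.const 0 1) (.const 0 0)) ?_
    simp only [wp, ← hall]
    split_ifs with h
    · exact ⟨by omega, hs.root, fun h' => absurd h h', fun _ => rfl⟩
    · exact ⟨by omega, hs.root, fun _ => rfl, fun h' => absurd h h'⟩
  refine ((runs_stage hB hs hslot).seq fun s hs => (hP.runs_squares hs).seq fun s hs =>
    (haccept s hs).seq fun s hs => (hcheck s hs).seq hverdict).mono le_rfl ?_ fun s hs => hs
  exact le_of_eq (by ring)

end Verification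

section Construction

/-- The construction of the root: search for the only candidate, and verify it by means of two
multiplications with `P`. -/
def rootProg (P : Prog) : Prog :=
  .search ;; .verify P

theorem runs_rootProg {n B T : ℕ} {G : SimpleGraph (Fin n)} {v : Fin n} {U : Set (Fin n)}
    {P : Prog} (hB : n * n + 1 < B) (hP : SquaresIn n B P T) (hG : G.Connected) :
    Runs B (rootProg P) (rootInput G v U)
      (n * n * (Prog.searchStep.cost + Prog.stageStep.cost + Prog.checkEntry.cost + 15) + 2 * T +
        (Prog.startSearch.cost + 18)) fun s =>
      ((∃ H, IsRootWithNbhd G v U H) → s.reg 0 = 1 ∧ ∃ H, IsRootWithNbhd G v U H ∧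
        ∀ i j : Fin n, s.arr 2 (i * n + j) = adjacency H i j) ∧
      ((¬ ∃ H, IsRootWithNbhd G v U H) → s.reg 0 = 0) := by
  have hwrites : ∀ x ∈ Prog.search.writes, x ∉ Set.Ici 100 := by
    simp [Prog.search, Prog.startSearch, Prog.forGrid, Prog.gridInit, Prog.gridStep,
      Prog.searchStep, Prog.loadExplored, Prog.testEdge, Prog.recordEdge, Prog.writes]
  refine (((Prog.runs_search hB hG).frame hwrites).seq
    (T' := n * n * (Prog.stageStep.cost + Prog.checkEntry.cost + 10) + 2 * T + 14) ?_).mono le_rfl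
    (le_of_eq (by ring)) fun s hs => hs
  rintro s ⟨hagrees, R, hs, honly⟩
  have hslot (k : ℕ) : s.view (slot k) = squareInput 0 fun _ => 0 :=
    (hagrees.mono (range_slot_subset k)).view_eq.trans (view_slot_rootInput k)
  refine (Prog.runs_verify hB hP hs hslot).mono le_rfl le_rfl ?_
  rintro s' ⟨hroot, hyes, hno⟩
  refine ⟨fun ⟨H, hH⟩ => ⟨hyes ⟨H, hH, honly H hH⟩, H, hH, fun i j => ?_⟩,
    fun hex => hno fun ⟨H, hH, _⟩ => hex ⟨H, hH⟩⟩
  rw [hroot, matrixArray_entry, ← honly H hH]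
  rfl

theorem MultipliesMatricesIn.exists_constructsRootIn {P : Prog} {M : ℕ → ℕ}
    (hP : MultipliesMatricesIn P M) :
    ∃ (Q : Prog) (C : ℕ), ConstructsRootIn Q fun n => C * M n := by
  have hM := hP.mul_self_le
  obtain ⟨c, hP⟩ := hP
  refine ⟨rootProg P, Prog.searchStep.cost + Prog.stageStep.cost + Prog.checkEntry.cost + 15 + 2 +
    (Prog.startSearch.cost + 18), c + 2, fun n G v U hG _ => ?_⟩
  have hB : n * n + 1 < (n + 2) ^ (c + 2) :=
    calc n * n + 1 < (n + 2) ^ 2 := by linarith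
      _ ≤ (n + 2) ^ (c + 2) := Nat.pow_le_pow_right (by omega) (by omega)
  have hsquares : SquaresIn n ((n + 2) ^ (c + 2)) P (M n) := fun A hA =>
    Runs.mono (hP n A A hA hA) (Nat.pow_le_pow_right (by omega) (by omega)) le_rfl fun _ h => h
  have hone : 1 ≤ M n := (Nat.mul_pos v.pos v.pos).trans_le (hM n)
  refine (runs_rootProg hB hsquares hG).mono le_rfl ?_ fun s hs => hs
  dsimp only
  rw [add_mul, add_mul, mul_comm (n * n)]
  gcongr
  · exact hM n
  · exact Nat.le_mul_of_pos_right _ hone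

end Construction

end SquareRoot

open SquareRoot in
theorem mainTheorem6_general :
    (∀ (V : Type*) (G H : SimpleGraph V), C3C5Free H → power H 2 = G →
      ∀ x y : V, y ∈ H.neighborSet x →
        H.neighborSet y = G.neighborSet y ∩ (insert x (G.neighborSet x) \ H.neighborSet x)) ∧
    (∀ (V : Type*) (G : SimpleGraph V), G.Connected → ∀ (v : V) (U : Set V),
      ∀ H₁ H₂ : SimpleGraph V, IsRootWithNbhd G v U H₁ → IsRootWithNbhd G v U H₂ → H₁ = H₂) ∧
    (∀ (P : Prog) (M : ℕ → ℕ), MultipliesMatricesIn P M →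
      ∃ (Q : Prog) (C : ℕ), ConstructsRootIn Q (fun n => C * M n)) := by
  refine ⟨?_, ?_, fun P M hP => hP.exists_constructsRootIn⟩
  · rintro V _ H hH rfl x y hxy
    exact hH.neighborSet_eq hxy
  · exact fun V G hG v U H₁ H₂ h₁ h₂ => h₁.unique hG h₂

open SquareRoot in
theorem mainTheorem6 :
    -- the neighborhood of an end of an edge of the root is determined by that of the other end
    (∀ (V : Type*) [Finite V] (G H : SimpleGraph V), C3C5Free H → power H 2 = G →
      ∀ x y : V, y ∈ H.neighborSet x →
        H.neighborSet y = G.neighborSet y ∩ (insert x (G.neighborSet x) \ H.neighborSet x)) ∧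
    -- there is at most one solution
    (∀ (V : Type*) [Finite V] (G : SimpleGraph V), G.Connected →
      ∀ (v : V) (U : Set V), U ⊆ G.neighborSet v →
        ∀ H₁ H₂ : SimpleGraph V, IsRootWithNbhd G v U H₁ → IsRootWithNbhd G v U H₂ → H₁ = H₂) ∧
    -- it is constructed within a constant factor of the time of any matrix multiplication
    (∀ (P : Prog) (M : ℕ → ℕ), MultipliesMatricesIn P M →
      ∃ (Q : Prog) (C : ℕ), ConstructsRootIn Q (fun n => C * M n)) := by
  obtain ⟨h₁, h₂, h₃⟩ := mainTheorem6_general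
  exact ⟨fun V _ => h₁ V, fun V _ G hG v U _ => h₂ V G hG v U, h₃⟩
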